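/- Let $R$ be an integral domain with quotient field $K$. Definitions. An ideal $I$ of $R$ is *strongly prime* (respectively, *strongly primary*) if for all $x,y\in K$ with $xy\in I$ one has $x\in I$ or $y\in I$ (respectively, $x\in I$ or $y^n\in I$ for some integer $n\ge 1$). $R$ is a *PVD* (respectively, an *APVD*) if every prime ideal of $R$ is strongly prime (respectively, strongly primary); $R$ is an *LPVD* (respectively, an *LAPVD*) if $R_M$ is a PVD (respectively, an APVD) for every maximal ideal $M$ of $R$; $R$ is a *Prüfer domain* if $R_M$ is a valuation domain for every maximal ideal $M$. (Fields count as valuation domains.) For $R$-submodules $I,J$ of $K$ put $I:J=\{x\in K: xJ\subseteq I\}$. A nonzero ideal $I$ of $R$ is *divisorial* if $R:(R:I)=I$, and $R$ is a *Mori domain* if it satisfies the ascending chain condition on divisorial ideals. If $R$ is an APVD, it has a unique maximal ideal $M$, and its *associated valuation overring* $V$ is the unique valuation domain with $R'\subseteq V\subseteq K$ that has the same prime ideals (as subsets of $K$) as the integral closure $R'$ of $R$ in $K$; $M$ is then an ideal of $V$. For $n\ge 1$, a proper ideal $I$ of $R$ is *$n$-absorbing* if whenever $a_1\cdots a_{n+1}\in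 I$ with all $a_i\in R$, there is an $i$ with $\prod_{j\ne i}a_j\in I$. $\operatorname{AF-dim}(R)$ is the least integer $n\ge 1$ such that every proper ideal of $R$ is a finite product of $n$-absorbing ideals of $R$, and $\infty$ if there is no such $n$. Theorem. 1. If $R$ is an APVD of Krull dimension one whose maximal ideal $M$ is a principal ideal of its associated valuation overring $V$, then $\operatorname{AF-dim}(R)\le 3$. 2. If $R$ is a Mori LAPVD, then $\operatorname{AF-dim}(R)\le 3$. 3. Let $R$ be a Mori domain. Then $\operatorname{AF-dim}(R)=1$ if and only if $R$ is a Prüfer domain; $\operatorname{AF-dim}(R)=2$ if and only if $R$ is an LPVD that is not a Prüfer domain; and $\operatorname{AF-dim}(R)=3$ if $R$ is an LAPVD that is not an LPVD. -/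

import Mathlib

open scoped nonZeroDivisors

universe u

section Defs

/-- An ideal `I` of a domain `R` with quotient field `K` is strongly prime if for all `x y : K` with
`x * y ∈ I`, either `x ∈ I` or `y ∈ I`. -/
def IsStronglyPrime {R : Type u} [CommRing R] [IsDomain R] (I : Ideal R) : Prop :=
  ∀ x y : FractionRing R, x * y ∈ (algebraMap R (FractionRing R)) '' (I : Set R) →
    x ∈ (algebraMap R (FractionRing R)) '' (I : Set R) ∨
    y ∈ (algebraMap R (FractionRing R)) '' (I : Set R)

/-- An ideal `I` of a domain `R` with quotient field `K` is strongly primary if for all `x y : K`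
with `x * y ∈ I`, either `x ∈ I` or `y ^ n ∈ I` for some positive integer `n`. -/
def IsStronglyPrimary {R : Type u} [CommRing R] [IsDomain R] (I : Ideal R) : Prop :=
  ∀ x y : FractionRing R, x * y ∈ (algebraMap R (FractionRing R)) '' (I : Set R) →
    x ∈ (algebraMap R (FractionRing R)) '' (I : Set R) ∨
    ∃ n : ℕ, 0 < n ∧ y ^ n ∈ (algebraMap R (FractionRing R)) '' (I : Set R)

/-- Pseudo-valuation domain: every prime ideal is strongly prime. -/
def IsPVD (R : Type u) [CommRing R] [IsDomain R] : Prop :=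
  ∀ P : Ideal R, P.IsPrime → IsStronglyPrime P

/-- Almost pseudo-valuation domain: every prime ideal is strongly primary. -/
def IsAPVD (R : Type u) [CommRing R] [IsDomain R] : Prop :=
  ∀ P : Ideal R, P.IsPrime → IsStronglyPrimary P

/-- Locally pseudo-valuation domain. -/
def IsLPVD (R : Type u) [CommRing R] [IsDomain R] : Prop :=
  ∀ (M : Ideal R) [M.IsMaximal], IsPVD (Localization.AtPrime M)

/-- Locally almost pseudo-valuation domain. -/
def IsLAPVD (R : Type u) [CommRing R] [IsDomain R] : Prop :=
  ∀ (M : Ideal R) [M.IsMaximal], IsAPVD (Localization.AtPrime M)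

/-- Prüfer domain: every localization at a maximal ideal is a valuation domain. -/
def IsPruferDomain (R : Type u) [CommRing R] [IsDomain R] : Prop :=
  ∀ (M : Ideal R) [M.IsMaximal], ValuationRing (Localization.AtPrime M)

/-- A nonzero ideal `I` of a domain `R` is divisorial if `R : (R : I) = I`, where for fractional
ideals `A / B = {x ∈ K | x B ⊆ A}`. -/
def IsDivisorialIdeal {R : Type u} [CommRing R] [IsDomain R] (I : Ideal R) : Prop :=
  I ≠ ⊥ ∧ 1 / (1 / (I : FractionalIdeal R⁰ (FractionRing R))) =
    (I : FractionalIdeal R⁰ (FractionRing R))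

/-- Mori domain: every ascending chain of divisorial ideals is stationary. -/
def IsMoriDomain (R : Type u) [CommRing R] [IsDomain R] : Prop :=
  ∀ f : ℕ → Ideal R, Monotone f → (∀ k, IsDivisorialIdeal (f k)) →
    ∃ k, ∀ l, k ≤ l → f l = f k

/-- The set of prime ideals of an overring `T` of `R`, regarded as subsets of the quotient field. -/
def primeSets {R : Type u} [CommRing R] [IsDomain R] (T : Subalgebra R (FractionRing R)) :
    Set (Set (FractionRing R)) :=
  {S | ∃ P : Ideal T, P.IsPrime ∧ (Subtype.val '' (P : Set T)) = S}

/-- `V` is the associated valuation overring of the domain `R`: it is a valuation overring of the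
integral closure `R'` of `R` in its quotient field, and `R'` and `V` have the same prime ideals
(as subsets of the quotient field). There is at most one such `V`, and if `R` is an almost
pseudo-valuation domain there is exactly one. -/
structure IsAssociatedValuationOverring (R : Type u) [CommRing R] [IsDomain R]
    (V : Subalgebra R (FractionRing R)) : Prop where
  integralClosure_le : integralClosure R (FractionRing R) ≤ V
  valuationRing : ValuationRing V
  primeSets_eq : primeSets (integralClosure R (FractionRing R)) = primeSets V

/-- A proper ideal `I` is `n`-absorbing if whenever a product of `n + 1` elements lies in `I`,
the product of some `n` of these (omitting one factor) lies in `I`. -/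
def IsNAbsorbing {R : Type u} [CommRing R] (n : ℕ) (I : Ideal R) : Prop :=
  I ≠ ⊤ ∧ ∀ a : Fin (n + 1) → R, ∏ i, a i ∈ I →
    ∃ i, ∏ j ∈ Finset.univ.erase i, a j ∈ I

/-- Every proper ideal of `R` is a finite product of `n`-absorbing ideals. -/
def HasAbsorbingFactorization (R : Type u) [CommRing R] (n : ℕ) : Prop :=
  ∀ I : Ideal R, I ≠ ⊤ → ∃ s : Multiset (Ideal R), (∀ J ∈ s, IsNAbsorbing n J) ∧ s.prod = I

/-- The AF-dimension: the least positive integer `n` such that every proper ideal is a finite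
product of `n`-absorbing ideals, and `⊤` if there is none. -/
noncomputable def AFdim (R : Type u) [CommRing R] : ℕ∞ :=
  ⨅ n ∈ {n : ℕ | 0 < n ∧ HasAbsorbingFactorization R n}, (n : ℕ∞)

end Defs

/-! An ideal lying between `M ^ n` and a maximal ideal `M` is `n`-absorbing
(`isNAbsorbing_of_pow_le`), so upper bounds on the AF-dimension come from factoring ideals into such
pieces.

Locally, let `V = M : M`. For a nonzero strongly primary `M`, `V` is a valuation ring, and
`mulMaximalColon x` is the trace of `xV` on the ring. These traces are divisorial, so the Mori
condition yields `M = aV` and `⋂ aⁿM = 0`; in part 1 these come from the hypothesis on `V` and from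
dimension one. If `y ∈ M` is not in `aM`, then `M ^ N ⊆ (y)`, with `N = 3` for an APVD, `2` for a
PVD and `1` for a valuation domain. This is `IsAbsorbingParameter`. Dividing a nonzero proper ideal
by the largest possible power of `a` leaves an ideal containing `M ^ N`, and `(a)` contains `M ^ N`
too, so the ideal is a product of `N`-absorbing ideals.

Globally, common denominators in a Mori domain show that each nonzero ideal contains a finite
product of powers of maximal ideals. It is then a product of primary ideals, each factored in its
own localization.

For the converses, both hypotheses localize, and a Mori domain is atomic. In a local domain with
2-absorbing factorization every irreducible `x` generates a 2-absorbing ideal; the crux is that its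
radical is `M` (`HasAbsorbingFactorization.radical_span_irreducible`). Hence `M² ⊆ xM`, so `xM` is
the same for all irreducibles, and `rM = aⁿM` defines a discrete value `n` of `r`. Comparing values
gives a PVD, and a valuation domain when the factors are prime. Thus AF-dimension at most 2 forces
an LPVD, which leaves exactly 3 for the remaining LAPVDs. -/

theorem Ideal.IsMaximal.mem_of_mul_mem_of_pow_le {R : Type u} [CommRing R] {M J : Ideal R}
    (hM : M.IsMaximal) {k : ℕ} (hJ : M ^ k ≤ J) {x y : R} (hx : x ∉ M) (hxy : x * y ∈ J) :
    y ∈ J := by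
  obtain ⟨b, i, hi, hbi⟩ := hM.exists_inv hx
  have hc : IsCoprime (Ideal.span {x}) M := Ideal.isCoprime_iff_exists.2
    ⟨b * x, Ideal.mem_span_singleton'.2 ⟨b, rfl⟩, i, hi, hbi⟩
  obtain ⟨c, hc, d, hd, hcd⟩ := Ideal.isCoprime_iff_exists.1 (hc.pow_right (n := k))
  obtain ⟨e, rfl⟩ := Ideal.mem_span_singleton'.1 hc
  have : y = e * (x * y) + d * y := by
    rw [← mul_assoc, ← add_mul, hcd, one_mul]
  rw [this]
  exact J.add_mem (J.mul_mem_left _ hxy) (J.mul_mem_right _ (hJ hd))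

/-! ### Absorbing ideals, AF-dimension and localization -/

section Absorbing

variable {R : Type u} [CommRing R]

/-- If all factors lie in `M`, any `n` of them multiply into `M ^ n`. Otherwise a factor outside `M`
is invertible modulo `M ^ n` and can be cancelled. -/
theorem isNAbsorbing_of_pow_le {M J : Ideal R} (hM : M.IsMaximal) {n : ℕ} (h1 : M ^ n ≤ J)
    (h2 : J ≤ M) : IsNAbsorbing n J := by
  refine ⟨fun h => hM.ne_top (top_le_iff.1 (h ▸ h2)), fun a ha => ?_⟩
  by_cases h : ∀ i, a i ∈ M
  · refine ⟨0, h1 ?_⟩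
    have := Ideal.prod_mem_prod (s := Finset.univ.erase (0 : Fin (n + 1))) (I := fun _ => M)
      (x := a) fun i _ => h i
    simpa using this
  · push Not at h
    obtain ⟨i, hi⟩ := h
    refine ⟨i, hM.mem_of_mul_mem_of_pow_le h1 hi ?_⟩
    rwa [Finset.mul_prod_erase _ _ (Finset.mem_univ i)]

theorem Ideal.IsPrime.isNAbsorbing {P : Ideal R} (hP : P.IsPrime) {n : ℕ} (hn : 0 < n) :
    IsNAbsorbing n P := by
  refine ⟨hP.ne_top, fun a ha => ?_⟩
  obtain ⟨i, -, hi⟩ := (hP.prod_mem_iff).1 ha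
  have : Nontrivial (Fin (n + 1)) := Fin.nontrivial_iff_two_le.2 (by omega)
  obtain ⟨j, hj⟩ := exists_ne i
  exact ⟨j, P.mem_of_dvd (Finset.dvd_prod_of_mem a (by simpa using hj.symm)) hi⟩

theorem IsNAbsorbing.isPrime {J : Ideal R} (hJ : IsNAbsorbing 1 J) : J.IsPrime := by
  refine ⟨hJ.1, fun {x y} hxy => ?_⟩
  obtain ⟨i, hi⟩ := hJ.2 ![x, y] (by simpa using hxy)
  have h0 : (Finset.univ.erase (0 : Fin 2)) = {1} := by decide
  have h1 : (Finset.univ.erase (1 : Fin 2)) = {0} := by decide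
  fin_cases i
  · right; simpa [h0] using hi
  · left; simpa [h1] using hi

theorem IsNAbsorbing.mul_mem {J : Ideal R} (hJ : IsNAbsorbing 2 J) {x y z : R}
    (h : x * y * z ∈ J) : x * y ∈ J ∨ x * z ∈ J ∨ y * z ∈ J := by
  obtain ⟨i, hi⟩ := hJ.2 ![x, y, z] (by simpa [Fin.prod_univ_three] using h)
  have h0 : (Finset.univ.erase (0 : Fin 3)) = {1, 2} := by decide
  have h1 : (Finset.univ.erase (1 : Fin 3)) = {0, 2} := by decide
  have h2 : (Finset.univ.erase (2 : Fin 3)) = {0, 1} := by decide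
  fin_cases i
  · right; right; simpa [h0] using hi
  · right; left; simpa [h1] using hi
  · left; simpa [h2] using hi

theorem IsNAbsorbing.sq_mem_of_mem_radical {J : Ideal R} (hJ : IsNAbsorbing 2 J) {x : R}
    (hx : x ∈ J.radical) : x ^ 2 ∈ J := by
  obtain ⟨n, hn⟩ := hx
  induction n using Nat.strong_induction_on with
  | _ n ih =>
    rcases le_or_gt n 2 with h | h
    · exact J.mem_of_dvd (pow_dvd_pow x h) hn
    · obtain ⟨m, rfl⟩ := Nat.exists_eq_add_of_lt h
      have h3 : x * x * x ^ (m + 1) ∈ J := by convert hn using 1; ring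
      rcases hJ.mul_mem h3 with h4 | h4
      · simpa [sq] using h4
      · refine ih (m + 2) (by omega) ?_
        rcases h4 with h4 | h4 <;> · convert h4 using 1; ring

/-- A `2`-absorbing ideal contains the square of its radical, if the latter is prime. -/
theorem IsNAbsorbing.sq_radical_le {J P : Ideal R} (hJ : IsNAbsorbing 2 J)
    (hP : J.radical = P) (hPJ : P.IsPrime) : P ^ 2 ≤ J := by
  subst hP
  rw [sq, Ideal.mul_le]
  intro x hx y hy
  have hx2 := hJ.sq_mem_of_mem_radical hx
  have hy2 := hJ.sq_mem_of_mem_radical hy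
  -- Whichever pair is absorbed, subtracting `x ^ 2` or `y ^ 2`, both in `J`, leaves `x * y`.
  have h : x * (x + y) * y ∈ J := by
    have := J.add_mem (J.mul_mem_left y hx2) (J.mul_mem_left x hy2)
    convert this using 1; ring
  rcases hJ.mul_mem h with h | h | h
  · have := J.sub_mem h hx2
    convert this using 1; ring
  · exact h
  · have := J.sub_mem h hy2
    convert this using 1; ring

theorem AFdim_le {n : ℕ} (hn : 0 < n) (h : HasAbsorbingFactorization R n) : AFdim R ≤ n :=
  iInf₂_le n ⟨hn, h⟩

theorem le_AFdim {n : ℕ} (h : ∀ m, 0 < m → m < n → ¬ HasAbsorbingFactorization R m) :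
    n ≤ AFdim R :=
  le_iInf₂ fun m hm => by
    by_contra hlt
    exact h m hm.1 (by simpa using hlt) hm.2

theorem AFdim_eq_iff {n : ℕ} (hn : 0 < n) : AFdim R = n ↔ HasAbsorbingFactorization R n ∧
    ∀ m, 0 < m → m < n → ¬ HasAbsorbingFactorization R m := by
  have key : ∀ m, 0 < m → m < n → AFdim R = n → ¬ HasAbsorbingFactorization R m := by
    intro m hm hmn h hf
    have := AFdim_le hm hf
    rw [h] at this
    exact absurd (by exact_mod_cast this) (not_le.2 hmn)
  constructor
  · intro h
    refine ⟨?_, fun m hm hmn => key m hm hmn h⟩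
    by_contra hf
    have : ((n + 1 : ℕ) : ℕ∞) ≤ AFdim R := le_AFdim fun m hm hmn hm' => by
      rcases Nat.lt_succ_iff_lt_or_eq.1 hmn with h1 | rfl
      · exact key m hm h1 h hm'
      · exact hf hm'
    rw [h] at this
    exact absurd (by exact_mod_cast this) (Nat.not_succ_le_self n)
  · rintro ⟨h1, h2⟩
    exact le_antisymm (AFdim_le hn h1) (le_AFdim h2)

theorem IsNAbsorbing.map_localization {n : ℕ} {I : Ideal R} (hI : IsNAbsorbing n I) (P : Ideal R)
    [P.IsPrime] (h : I.map (algebraMap R (Localization.AtPrime P)) ≠ ⊤) :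
    IsNAbsorbing n (I.map (algebraMap R (Localization.AtPrime P))) := by
  refine ⟨h, fun a ha => ?_⟩
  have hs : ∀ i, ∃ r : R, ∃ s : P.primeCompl, a i * algebraMap R (Localization.AtPrime P) s =
      algebraMap R _ r := fun i => by
    obtain ⟨⟨r, s⟩, h⟩ := IsLocalization.surj P.primeCompl (a i)
    exact ⟨r, s, h⟩
  choose r s hrs using hs
  have hmem : algebraMap R (Localization.AtPrime P) (∏ i, r i) ∈
      I.map (algebraMap R (Localization.AtPrime P)) := by
    rw [map_prod, ← Finset.prod_congr rfl fun i _ => hrs i, Finset.prod_mul_distrib]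
    exact Ideal.mul_mem_right _ _ ha
  rw [IsLocalization.algebraMap_mem_map_algebraMap_iff P.primeCompl] at hmem
  obtain ⟨u, hu, hur⟩ := hmem
  -- Multiplying every factor by `u` avoids deciding which factor should carry it; powers of `u` are
  -- invertible after localization.
  obtain ⟨i, hi⟩ := hI.2 (fun i => u * r i) (by
    rw [Finset.prod_mul_distrib, Finset.prod_const, Finset.card_univ, Fintype.card_fin, pow_succ,
      mul_assoc]
    exact I.mul_mem_left _ hur)
  refine ⟨i, ?_⟩
  rw [Finset.prod_mul_distrib, Finset.prod_const] at hi
  have h2 : algebraMap R (Localization.AtPrime P) (∏ j ∈ Finset.univ.erase i, r j) ∈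
      I.map (algebraMap R (Localization.AtPrime P)) := by
    rw [IsLocalization.algebraMap_mem_map_algebraMap_iff P.primeCompl]
    exact ⟨_, P.primeCompl.pow_mem hu _, hi⟩
  rw [map_prod, ← Finset.prod_congr rfl fun i _ => hrs i, Finset.prod_mul_distrib, mul_comm,
    ← map_prod] at h2
  refine (Ideal.unit_mul_mem_iff_mem _ ?_).1 h2
  have := IsLocalization.map_units (Localization.AtPrime P) (∏ j ∈ Finset.univ.erase i, s j)
  simpa using this

theorem HasAbsorbingFactorization.localization {n : ℕ} (h : HasAbsorbingFactorization R n)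
    (P : Ideal R) [P.IsPrime] : HasAbsorbingFactorization (Localization.AtPrime P) n := by
  classical
  intro I hI
  have hI' : (I.comap (algebraMap R (Localization.AtPrime P))).map
      (algebraMap R (Localization.AtPrime P)) = I := IsLocalization.map_under P.primeCompl _ I
  obtain ⟨s, hs, hsI⟩ := h (I.comap (algebraMap R (Localization.AtPrime P)))
    (fun h => hI (by rw [← hI', h, Ideal.map_top]))
  let t := s.map (Ideal.mapHom (algebraMap R (Localization.AtPrime P)))
  have ht : t.prod = I := by
    rw [← map_multiset_prod, hsI]; exact hI'
  -- Factors not contained in `P` become the unit ideal, which is not absorbing, so they are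
  -- dropped.
  refine ⟨t.filter (· ≠ ⊤), fun J hJ => ?_, ?_⟩
  · rw [Multiset.mem_filter, Multiset.mem_map] at hJ
    obtain ⟨⟨A, hA, rfl⟩, hJ⟩ := hJ
    exact (hs A hA).map_localization P hJ
  · rw [← ht, ← Multiset.prod_filter_mul_prod_filter_not (s := t) (· ≠ ⊤)]
    rw [Multiset.prod_eq_one (s := t.filter fun a => ¬ a ≠ ⊤), mul_one]
    intro x hx
    simpa using (Multiset.mem_filter.1 hx).2

end Absorbing

/-! ### Divisorial ideals, Mori domains and their localizations -/

section Mori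

variable {R : Type u} [CommRing R] [IsDomain R]

/-- The elements of `R : I` are the fractions `c / d` with `d ∣ c * i` for all `i ∈ I`, so double
duals can be handled by divisibility in `R`. The double dual stays inside `R` because `1 ∈ R : I`.
-/
theorem isDivisorialIdeal_iff {I : Ideal R} : IsDivisorialIdeal I ↔ I ≠ ⊥ ∧
    ∀ r, (∀ c d : R, d ≠ 0 → (∀ i ∈ I, d ∣ c * i) → d ∣ c * r) → r ∈ I := by
  refine and_congr_right fun hI => ?_
  have hI0 : (I : FractionalIdeal R⁰ (FractionRing R)) ≠ 0 :=
    FractionalIdeal.coeIdeal_ne_zero.2 hI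
  have h1 : (1 / (I : FractionalIdeal R⁰ (FractionRing R))) ≠ 0 := by
    intro h
    have : (1 : FractionRing R) ∈ (1 / (I : FractionalIdeal R⁰ (FractionRing R))) := by
      rw [FractionalIdeal.mem_div_iff_of_ne_zero hI0]
      intro y hy
      rw [one_mul]
      exact FractionalIdeal.coeIdeal_le_one hy
    rw [h, FractionalIdeal.mem_zero_iff] at this
    exact one_ne_zero this
  have hfrac : ∀ c d r : R, d ≠ 0 →
      ((algebraMap R (FractionRing R) c / algebraMap R (FractionRing R) d) *
        algebraMap R (FractionRing R) r ∈ (1 : FractionalIdeal R⁰ (FractionRing R)) ↔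
        d ∣ c * r) := by
    intro c d r hd
    have hd' : algebraMap R (FractionRing R) d ≠ 0 := by simpa using hd
    rw [FractionalIdeal.mem_one_iff]
    constructor
    · rintro ⟨x, hx⟩
      refine ⟨x, IsFractionRing.injective R (FractionRing R) ?_⟩
      rw [map_mul, map_mul, hx]
      field_simp
    · rintro ⟨x, hx⟩
      refine ⟨x, ?_⟩
      have := congrArg (algebraMap R (FractionRing R)) hx
      rw [map_mul, map_mul] at this
      field_simp
      rw [this, mul_comm]
  have hmem : ∀ c d : R, d ≠ 0 →
      (algebraMap R (FractionRing R) c / algebraMap R (FractionRing R) d ∈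
        (1 / (I : FractionalIdeal R⁰ (FractionRing R))) ↔ ∀ i ∈ I, d ∣ c * i) := by
    intro c d hd
    rw [FractionalIdeal.mem_div_iff_of_ne_zero hI0]
    constructor
    · intro h i hi
      exact (hfrac c d i hd).1 (h _ (FractionalIdeal.mem_coeIdeal_of_mem _ hi))
    · intro h y hy
      obtain ⟨i, hi, rfl⟩ := (FractionalIdeal.mem_coeIdeal _).1 hy
      exact (hfrac c d i hd).2 (h i hi)
  have hle : (I : FractionalIdeal R⁰ (FractionRing R)) ≤
      1 / (1 / (I : FractionalIdeal R⁰ (FractionRing R))) := by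
    intro x hx
    rw [FractionalIdeal.mem_div_iff_of_ne_zero h1]
    intro y hy
    rw [mul_comm]
    exact (FractionalIdeal.mem_div_iff_of_ne_zero hI0).1 hy x hx
  have hdd : ∀ r : R, (∀ c d : R, d ≠ 0 → (∀ i ∈ I, d ∣ c * i) → d ∣ c * r) ↔
      algebraMap R (FractionRing R) r ∈ 1 / (1 / (I : FractionalIdeal R⁰ (FractionRing R))) := by
    intro r
    rw [FractionalIdeal.mem_div_iff_of_ne_zero h1]
    constructor
    · intro h y hy
      obtain ⟨c, d, hd, rfl⟩ := IsFractionRing.div_surjective (A := R) y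
      have hd := nonZeroDivisors.ne_zero hd
      rw [mul_comm]
      exact (hfrac c d r hd).2 (h c d hd ((hmem c d hd).1 hy))
    · intro h c d hd hc
      have := h _ ((hmem c d hd).2 hc)
      rw [mul_comm] at this
      exact (hfrac c d r hd).1 this
  constructor
  · intro h r hr
    have := (hdd r).1 hr
    rw [h] at this
    obtain ⟨i, hi, hir⟩ := (FractionalIdeal.mem_coeIdeal _).1 this
    rwa [← IsFractionRing.injective R (FractionRing R) hir]
  · intro h
    refine le_antisymm (fun x hx => ?_) hle
    have hx1 : x ∈ (1 : FractionalIdeal R⁰ (FractionRing R)) := by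
      have h11 : (1 : FractionRing R) ∈ (1 / (I : FractionalIdeal R⁰ (FractionRing R))) := by
        rw [FractionalIdeal.mem_div_iff_of_ne_zero hI0]
        intro y hy
        rw [one_mul]
        exact FractionalIdeal.coeIdeal_le_one hy
      have := (FractionalIdeal.mem_div_iff_of_ne_zero h1).1 hx 1 h11
      rwa [mul_one] at this
    obtain ⟨r, rfl⟩ := (FractionalIdeal.mem_one_iff _).1 hx1
    exact FractionalIdeal.mem_coeIdeal_of_mem _ (h r ((hdd r).2 hx))

theorem IsMoriDomain.exists_maximal (hR : IsMoriDomain R) {ι : Type*} [Nonempty ι]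
    (f : ι → Ideal R) (hf : ∀ i, IsDivisorialIdeal (f i)) : ∃ i, ∀ j, f i ≤ f j → f j = f i := by
  have hwf : WellFoundedGT {I : Ideal R // IsDivisorialIdeal I} :=
    wellFoundedGT_iff_monotone_chain_condition.2 fun a => by
      obtain ⟨k, hk⟩ := hR (fun n => (a n).1) (fun m n h => a.monotone h) fun n => (a n).2
      exact ⟨k, fun l hl => Subtype.ext (hk l hl).symm⟩
  obtain ⟨m, ⟨i, rfl⟩, hm⟩ := hwf.wf.has_min
    (Set.range fun i => (⟨f i, hf i⟩ : {I : Ideal R // IsDivisorialIdeal I})) (Set.range_nonempty _)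
  refine ⟨i, fun j hij => ?_⟩
  by_contra hne
  exact hm _ ⟨j, rfl⟩ (lt_of_le_of_ne hij fun h => hne (congrArg Subtype.val h).symm)

/-- The ideal `{r | d ∣ c * r}`. -/
def dvdIdeal (c d : R) : Ideal R := Submodule.comap (LinearMap.mulLeft R c) (Ideal.span {d})

theorem mem_dvdIdeal {c d r : R} : r ∈ dvdIdeal c d ↔ d ∣ c * r := by
  simp [dvdIdeal, Ideal.mem_span_singleton]

theorem isDivisorialIdeal_dvdIdeal {c d : R} (hd : d ≠ 0) : IsDivisorialIdeal (dvdIdeal c d) := by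
  refine isDivisorialIdeal_iff.2 ⟨?_, fun r h => ?_⟩
  · exact (Submodule.ne_bot_iff _).2 ⟨d, mem_dvdIdeal.2 (dvd_mul_left d c), hd⟩
  · exact mem_dvdIdeal.2 (h c d hd fun i hi => mem_dvdIdeal.1 hi)

/-- Nonzero principal ideals are divisorial, so they satisfy the ascending chain condition. -/
theorem IsMoriDomain.wfDvdMonoid (hR : IsMoriDomain R) : WfDvdMonoid R := by
  refine ⟨WellFounded.wellFounded_iff_has_min.2 fun s hs => ?_⟩
  by_cases hs0 : ∀ x ∈ s, x = 0
  · obtain ⟨x, hx⟩ := hs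
    refine ⟨x, hx, fun y hy h => h.1 (hs0 y hy)⟩
  · push Not at hs0
    obtain ⟨x0, hx0, hx0'⟩ := hs0
    have : Nonempty {x // x ∈ s ∧ x ≠ 0} := ⟨⟨x0, hx0, hx0'⟩⟩
    obtain ⟨⟨x, hx, hx'⟩, hmax⟩ := hR.exists_maximal
      (fun x : {x // x ∈ s ∧ x ≠ 0} => dvdIdeal 1 x.1) fun x => isDivisorialIdeal_dvdIdeal x.2.2
    refine ⟨x, hx, fun y hy h => ?_⟩
    obtain ⟨hy0, z, hz, rfl⟩ := h
    have := hmax ⟨y, hy, hy0⟩ fun r hr => by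
      rw [mem_dvdIdeal] at hr ⊢
      exact (dvd_mul_right y z).trans hr
    have hyz : y ∈ dvdIdeal 1 (y * z) := by
      rw [← this, mem_dvdIdeal, one_mul]
    rw [mem_dvdIdeal, one_mul] at hyz
    obtain ⟨w, hw⟩ := hyz
    rw [mul_assoc] at hw
    exact hz (IsUnit.of_mul_eq_one w (mul_left_cancel₀ hy0 (by rw [← hw, mul_one])))

/-- In a Mori domain, divisibility in a localization is witnessed by a common denominator. -/
theorem IsMoriDomain.exists_common_denom (hR : IsMoriDomain R) (P : Ideal R) [P.IsPrime] (c : R)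
    {d : R} (hd : d ≠ 0) : ∃ s ∉ P, ∀ r, algebraMap R (Localization.AtPrime P) d ∣
      algebraMap R (Localization.AtPrime P) (c * r) → d ∣ s * c * r := by
  -- Multiplying `s` by another denominator enlarges the ideal, so a maximal member already absorbs
  -- every denominator.
  obtain ⟨⟨s, hs⟩, hmax⟩ := hR.exists_maximal (fun s : P.primeCompl => dvdIdeal (s * c) d)
    fun s => isDivisorialIdeal_dvdIdeal hd
  refine ⟨s, hs, fun r hr => ?_⟩
  rw [← Ideal.mem_span_singleton, ← Set.image_singleton, ← Ideal.map_span,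
    IsLocalization.algebraMap_mem_map_algebraMap_iff P.primeCompl] at hr
  obtain ⟨t, ht, hr⟩ := hr
  rw [Ideal.mem_span_singleton] at hr
  have := hmax ⟨s * t, P.primeCompl.mul_mem hs ht⟩ fun x hx => by
    rw [mem_dvdIdeal] at hx ⊢
    exact hx.trans ⟨t, by simp only; ring⟩
  rw [← mem_dvdIdeal, ← this, mem_dvdIdeal]
  exact hr.trans ⟨s, by simp only; ring⟩

/-- Contraction to `R` is injective on ideals and preserves divisoriality: a fraction over the
localization multiplying the ideal into it can be scaled by one `s ∉ P` to do so over `R`. -/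
theorem IsMoriDomain.localization (hR : IsMoriDomain R) (P : Ideal R) [P.IsPrime] :
    IsMoriDomain (Localization.AtPrime P) := by
  intro f hf hdiv
  obtain ⟨k, hk⟩ := hR (fun n => (f n).comap (algebraMap R (Localization.AtPrime P)))
    (fun m n h => Ideal.comap_mono (hf h)) (fun n => by
      obtain ⟨h0, h⟩ := isDivisorialIdeal_iff.1 (hdiv n)
      refine isDivisorialIdeal_iff.2 ⟨fun h1 => h0 ?_, fun r hr => ?_⟩
      · rw [← IsLocalization.map_under P.primeCompl (Localization.AtPrime P) (f n)]
        exact (congrArg _ h1).trans Ideal.map_bot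
      · refine h _ fun c d hd hcd => ?_
        obtain ⟨c, t, rfl⟩ := IsLocalization.exists_mk'_eq P.primeCompl c
        obtain ⟨d, u, rfl⟩ := IsLocalization.exists_mk'_eq P.primeCompl d
        have hd0 : d ≠ 0 := by
          rintro rfl; exact hd (by simp)
        have key : ∀ x, IsLocalization.mk' (Localization.AtPrime P) d u ∣
            IsLocalization.mk' _ c t * x ↔ algebraMap R _ d ∣ algebraMap R _ c * x := by
          intro x
          have h1 : Associated (IsLocalization.mk' (Localization.AtPrime P) d u)
              (algebraMap R _ d) :=
            ⟨(IsLocalization.map_units (Localization.AtPrime P) u).unit, by simp⟩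
          have h2 : Associated (IsLocalization.mk' (Localization.AtPrime P) c t)
              (algebraMap R _ c) :=
            ⟨(IsLocalization.map_units (Localization.AtPrime P) t).unit, by simp⟩
          exact (h1.dvd_iff_dvd_left).trans (h2.mul_right x).dvd_iff_dvd_right
        rw [key]
        obtain ⟨s, hs, hsr⟩ := hR.exists_common_denom P c hd0
        obtain ⟨w, hw⟩ := hr (s * c) d hd0 fun i hi => hsr i (by
          rw [map_mul]; exact (key _).1 (hcd _ hi))
        have hsu := IsLocalization.map_units (Localization.AtPrime P) (⟨s, hs⟩ : P.primeCompl)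
        rw [← hsu.dvd_mul_left, ← mul_assoc, ← map_mul, ← map_mul, hw, map_mul]
        exact dvd_mul_right _ _)
  refine ⟨k, fun l hl => ?_⟩
  rw [← IsLocalization.map_under P.primeCompl (Localization.AtPrime P) (f l),
    ← IsLocalization.map_under P.primeCompl (Localization.AtPrime P) (f k)]
  exact congrArg _ (hk l hl)

end Mori

/-! ### Factorization by an absorbing parameter, and its source in the Mori condition -/

section AbsorbingParameter

open IsLocalRing

variable {S : Type u} [CommRing S]

/-- An element `a` of a local ring with maximal ideal `M` such that `⋂ aⁿ M = 0` and every
element of `M` outside `a M` generates an ideal containing `M ^ N`. -/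
structure IsAbsorbingParameter [IsLocalRing S] (N : ℕ) (a : S) : Prop where
  ne_zero : a ≠ 0
  mem : a ∈ maximalIdeal S
  exists_notMem : ∀ x ≠ 0, ∃ n : ℕ, x ∉ Ideal.span {a ^ n} * maximalIdeal S
  pow_le : ∀ y ∈ maximalIdeal S, y ∉ Ideal.span {a} * maximalIdeal S →
    maximalIdeal S ^ N ≤ Ideal.span {y}

variable [IsDomain S]

theorem mul_mem_span_singleton_mul_iff {a x : S} (ha : a ≠ 0) {I : Ideal S} {b : S} :
    a * x ∈ Ideal.span {a * b} * I ↔ x ∈ Ideal.span {b} * I := by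
  simp only [Ideal.mem_span_singleton_mul, mul_assoc]
  exact exists_congr fun z => and_congr_right fun _ => mul_right_inj' ha

variable [IsLocalRing S]

theorem notMem_span_singleton_mul_maximalIdeal {a : S} (ha : a ≠ 0) :
    a ∉ Ideal.span {a} * maximalIdeal S := by
  intro h
  obtain ⟨z, hz, h⟩ := Ideal.mem_span_singleton_mul.1 h
  have : z = 1 := mul_left_cancel₀ ha (by rw [h, mul_one])
  exact (Ideal.ne_top_iff_one _).1 (maximalIdeal.isMaximal S).ne_top (this ▸ hz)

namespace IsAbsorbingParameter

variable {N : ℕ} {a : S}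

theorem exists_prod_eq (h : IsAbsorbingParameter N a) {I : Ideal S} (hI0 : I ≠ ⊥) (hI : I ≠ ⊤) :
    ∃ s : Multiset (Ideal S), (∀ J ∈ s, maximalIdeal S ^ N ≤ J ∧ J ≤ maximalIdeal S) ∧
      s.prod = I := by
  classical
  obtain ⟨x, hxI, hx0⟩ := (Submodule.ne_bot_iff _).1 hI0
  have hex : ∃ n : ℕ, ¬ I ≤ Ideal.span {a ^ n} * maximalIdeal S := by
    obtain ⟨n, hn⟩ := h.exists_notMem x hx0
    exact ⟨n, fun h => hn (h hxI)⟩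
  -- The least failing exponent is positive since `I ⊆ M`; so `I ⊆ aⁿM` but `I ⊄ aⁿ⁺¹M`, and `J`
  -- below is `a⁻ⁿI`.
  obtain ⟨n, hn⟩ : ∃ n, Nat.find hex = n + 1 := by
    refine Nat.exists_eq_succ_of_ne_zero fun h0 => ?_
    have := Nat.find_spec hex
    rw [h0] at this
    simp [le_maximalIdeal hI] at this
  have h1 : I ≤ Ideal.span {a ^ n} * maximalIdeal S := by
    by_contra hc
    have := Nat.find_min' hex hc
    omega
  have h2 := Nat.find_spec hex
  rw [hn] at h2
  obtain ⟨y, hyI, hy⟩ := Set.not_subset.1 h2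
  have han : a ^ n ≠ 0 := pow_ne_zero n h.ne_zero
  let J : Ideal S := Submodule.comap (LinearMap.mulLeft S (a ^ n)) I
  have hJ : ∀ {z}, z ∈ J ↔ a ^ n * z ∈ I := Iff.rfl
  have hJM : J ≤ maximalIdeal S := by
    intro z hz
    obtain ⟨w, hw, hwz⟩ := Ideal.mem_span_singleton_mul.1 (h1 (hJ.1 hz))
    rwa [← mul_left_cancel₀ han hwz]
  have hIJ : Ideal.span {a} ^ n * J = I := by
    rw [Ideal.span_singleton_pow]
    refine le_antisymm (fun z hz => ?_) fun z hz => ?_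
    · obtain ⟨w, hw, rfl⟩ := Ideal.mem_span_singleton_mul.1 hz
      exact hw
    · obtain ⟨w, -, rfl⟩ := Ideal.mem_span_singleton_mul.1 (h1 hz)
      exact Ideal.mem_span_singleton_mul.2 ⟨w, hz, rfl⟩
  have hMJ : maximalIdeal S ^ N ≤ J := by
    obtain ⟨w, hw, rfl⟩ := Ideal.mem_span_singleton_mul.1 (h1 hyI)
    refine (h.pow_le w hw fun hwa => hy ?_).trans ((Ideal.span_singleton_le_iff_mem _).2 hyI)
    rw [pow_succ]
    exact (mul_mem_span_singleton_mul_iff han).2 hwa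
  refine ⟨J ::ₘ Multiset.replicate n (Ideal.span {a}), fun A hA => ?_, ?_⟩
  · rcases Multiset.mem_cons.1 hA with rfl | hA
    · exact ⟨hMJ, hJM⟩
    · rw [Multiset.eq_of_mem_replicate hA]
      exact ⟨h.pow_le a h.mem (notMem_span_singleton_mul_maximalIdeal h.ne_zero),
        (Ideal.span_singleton_le_iff_mem _).2 h.mem⟩
  · rw [Multiset.prod_cons, Multiset.prod_replicate, mul_comm, hIJ]

theorem exists_pow_le (h : IsAbsorbingParameter N a) {I : Ideal S} (hI0 : I ≠ ⊥) :
    ∃ k, maximalIdeal S ^ k ≤ I := by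
  by_cases hI : I = ⊤
  · exact ⟨0, hI ▸ le_top⟩
  obtain ⟨s, hs, rfl⟩ := h.exists_prod_eq hI0 hI
  clear hI hI0
  induction s using Multiset.induction_on with
  | empty => exact ⟨0, by simp⟩
  | cons J s ih =>
    obtain ⟨k, hk⟩ := ih fun A hA => hs A (Multiset.mem_cons_of_mem hA)
    exact ⟨N + k, by
      rw [Multiset.prod_cons, pow_add]
      exact Ideal.mul_mono (hs J (Multiset.mem_cons_self J s)).1 hk⟩

end IsAbsorbingParameter

/-- The ideal of all `s` with `s M ⊆ x M`, where `M` is the maximal ideal. -/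
def mulMaximalColon (x : S) : Ideal S :=
  (Ideal.span {x} * maximalIdeal S).colon (maximalIdeal S : Set S)

theorem mem_mulMaximalColon {x s : S} : s ∈ mulMaximalColon x ↔
    ∀ m ∈ maximalIdeal S, s * m ∈ Ideal.span {x} * maximalIdeal S :=
  Submodule.mem_colon

theorem self_mem_mulMaximalColon (x : S) : x ∈ mulMaximalColon x :=
  mem_mulMaximalColon.2 fun m hm => Ideal.mem_span_singleton_mul.2 ⟨m, hm, rfl⟩

theorem mulMaximalColon_le {x y : S} (h : x ∈ mulMaximalColon y) :
    mulMaximalColon x ≤ mulMaximalColon y := by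
  intro s hs
  rw [mem_mulMaximalColon] at *
  intro m hm
  obtain ⟨z, hz, hzm⟩ := Ideal.mem_span_singleton_mul.1 (hs m hm)
  rw [← hzm]
  exact h z hz

/-- An element `s` of the double dual satisfies `sM ⊆ (x)`. If `sM ⊄ xM`, some `s * m` is a unit
times `x`; this makes `M` principal, hence the colon ideal lies in `(x)`, and `x ∣ s` gives a
contradiction. -/
theorem isDivisorialIdeal_mulMaximalColon {x : S} (hx : x ≠ 0) :
    IsDivisorialIdeal (mulMaximalColon x) := by
  refine isDivisorialIdeal_iff.2
    ⟨(Submodule.ne_bot_iff _).2 ⟨x, self_mem_mulMaximalColon x, hx⟩, fun s hs => ?_⟩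
  by_contra hsx
  have hdvd : ∀ m ∈ maximalIdeal S, x ∣ s * m := by
    intro m hm
    rw [mul_comm]
    refine hs m x hx fun i hi => ?_
    obtain ⟨z, -, hz⟩ := Ideal.mem_span_singleton_mul.1 (mem_mulMaximalColon.1 hi m hm)
    exact ⟨z, by rw [hz, mul_comm]⟩
  rw [mem_mulMaximalColon] at hsx
  push Not at hsx
  obtain ⟨m, hm, hsm⟩ := hsx
  obtain ⟨u, hu⟩ := hdvd m hm
  have hu' : IsUnit u := by
    by_contra hu'
    exact hsm (Ideal.mem_span_singleton_mul.2 ⟨u, hu', hu.symm⟩)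
  obtain ⟨u, rfl⟩ := hu'
  have hm0 : m ≠ 0 := by
    rintro rfl
    rw [mul_zero, eq_comm, mul_eq_zero] at hu
    exact hu.elim hx u.ne_zero
  have hs0 : s ≠ 0 := by
    rintro rfl
    rw [zero_mul, eq_comm, mul_eq_zero] at hu
    exact hu.elim hx u.ne_zero
  have hxs : x = s * m * ↑u⁻¹ := by rw [hu, mul_assoc, Units.mul_inv, mul_one]
  -- the maximal ideal is generated by `m`
  have hM : ∀ m' ∈ maximalIdeal S, m ∣ m' := by
    intro m' hm'
    obtain ⟨w, hw⟩ := hdvd m' hm'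
    refine ⟨↑u⁻¹ * w, mul_left_cancel₀ hs0 ?_⟩
    rw [hw, hxs]; ring
  have hxs' : x ∣ s := by
    have := hs 1 x hx fun i hi => by
      obtain ⟨z, hz, hzi⟩ := Ideal.mem_span_singleton_mul.1 (mem_mulMaximalColon.1 hi m hm)
      obtain ⟨w, rfl⟩ := hM z hz
      refine ⟨w, mul_right_cancel₀ hm0 ?_⟩
      rw [one_mul, ← hzi]; ring
    simpa using this
  obtain ⟨w, rfl⟩ := hxs'
  exact hsm (Ideal.mem_span_singleton_mul.2 ⟨w * m, Ideal.mul_mem_left _ _ hm, by ring⟩)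

/-- In a local Mori domain which is an almost pseudo-valuation domain, the maximal ideal `M` is
a principal ideal `a V` of the valuation ring `V = M : M`. -/
theorem IsMoriDomain.exists_generator (hS : IsMoriDomain S) (hM : maximalIdeal S ≠ ⊥)
    (hV : ∀ x y : S, x ≠ 0 → y ≠ 0 → x ∈ mulMaximalColon y ∨ y ∈ mulMaximalColon x) :
    ∃ a ≠ 0, a ∈ maximalIdeal S ∧ (∀ x ∈ maximalIdeal S, x ∈ mulMaximalColon a) ∧
      ∀ x ≠ 0, ∃ n : ℕ, x ∉ Ideal.span {a ^ n} * maximalIdeal S := by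
  obtain ⟨x0, hx0, hx0'⟩ := (Submodule.ne_bot_iff _).1 hM
  have : Nonempty {x : S // x ≠ 0 ∧ x ∈ maximalIdeal S} := ⟨⟨x0, hx0', hx0⟩⟩
  obtain ⟨⟨a, ha0, ha⟩, hmax⟩ := hS.exists_maximal
    (fun x : {x : S // x ≠ 0 ∧ x ∈ maximalIdeal S} => mulMaximalColon x.1)
    fun x => isDivisorialIdeal_mulMaximalColon x.2.1
  refine ⟨a, ha0, ha, fun x hx => ?_, fun x hx => ?_⟩
  · by_cases hx0 : x = 0
    · rw [hx0]; exact zero_mem _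
    rcases hV x a hx0 ha0 with h | h
    · exact h
    · have := hmax ⟨x, hx0, hx⟩ (mulMaximalColon_le h)
      exact (show mulMaximalColon x = mulMaximalColon a from this) ▸ self_mem_mulMaximalColon x
  · by_contra hc
    push Not at hc
    choose m hm hmx using fun n => Ideal.mem_span_singleton_mul.1 (hc n)
    have hm0 : ∀ n, m n ≠ 0 := fun n h => hx (by rw [← hmx n, h, mul_zero])
    have hsucc : ∀ n, m n = a * m (n + 1) := fun n => by
      refine mul_left_cancel₀ (pow_ne_zero n ha0) ?_
      rw [hmx, ← hmx (n + 1)]; ring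
    -- The cofactors satisfy `m n = a * m (n + 1)`, so their colon ideals ascend. Stability at one
    -- step would put `a * m (n + 1)` into itself times `M`.
    obtain ⟨n, hn⟩ := hS.exists_maximal (fun n => mulMaximalColon (m n))
      fun n => isDivisorialIdeal_mulMaximalColon (hm0 n)
    have h1 : mulMaximalColon (m (n + 1)) = mulMaximalColon (m n) := hn (n + 1) <| by
      refine mulMaximalColon_le ?_
      rw [hsucc n]
      exact Ideal.mul_mem_left _ _ (self_mem_mulMaximalColon _)
    have h2 := h1 ▸ self_mem_mulMaximalColon (m (n + 1))
    have h3 := mem_mulMaximalColon.1 h2 a ha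
    rw [hsucc n] at h3
    rw [mul_comm (m (n + 1)) a] at h3
    exact notMem_span_singleton_mul_maximalIdeal (mul_ne_zero ha0 (hm0 _)) h3

end AbsorbingParameter

/-! ### Absorbing parameters in local APVDs, PVDs and valuation domains -/

section LocalPseudoValuation

open IsLocalRing

variable {S : Type u} [CommRing S] [IsDomain S]

theorem algebraMap_mem_image_iff {I : Ideal S} {x : S} :
    algebraMap S (FractionRing S) x ∈ algebraMap S (FractionRing S) '' (I : Set S) ↔ x ∈ I :=
  (IsFractionRing.injective S (FractionRing S)).mem_set_image

theorem isStronglyPrime_bot : IsStronglyPrime (⊥ : Ideal S) := by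
  rintro x y ⟨z, hz, hzxy⟩
  rw [SetLike.mem_coe, Ideal.mem_bot] at hz
  subst hz
  rw [map_zero, eq_comm, mul_eq_zero] at hzxy
  exact hzxy.imp (fun h => ⟨0, by simp, by simp [h]⟩) fun h => ⟨0, by simp, by simp [h]⟩

theorem IsStronglyPrime.isStronglyPrimary {I : Ideal S} (h : IsStronglyPrime I) :
    IsStronglyPrimary I :=
  fun x y hxy => (h x y hxy).imp_right fun hy => ⟨1, one_pos, by simpa using hy⟩

theorem ValuationRing.isPVD (h : ValuationRing S) : IsPVD S := by
  have hmul : ∀ (P : Ideal S) (x y : FractionRing S),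
      x * y ∈ algebraMap S (FractionRing S) '' (P : Set S) →
      (∃ r, algebraMap S (FractionRing S) r * x = 1) →
      y ∈ algebraMap S (FractionRing S) '' (P : Set S) := by
    rintro P x y ⟨p, hp, hpxy⟩ ⟨r, hr⟩
    refine ⟨r * p, P.mul_mem_left _ hp, ?_⟩
    rw [map_mul, hpxy, ← mul_assoc, hr, one_mul]
  intro P hP x y hxy
  rcases eq_or_ne x 0 with rfl | hx
  · exact Or.inl ⟨0, by simp, by simp⟩
  rcases eq_or_ne y 0 with rfl | hy
  · exact Or.inr ⟨0, by simp, by simp⟩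
  rcases ValuationRing.isInteger_or_isInteger S x with ⟨r, hr⟩ | ⟨r, hr⟩
  · rcases ValuationRing.isInteger_or_isInteger S y with ⟨t, ht⟩ | ⟨t, ht⟩
    · rw [← hr, ← ht, ← map_mul, algebraMap_mem_image_iff] at hxy
      rw [← hr, ← ht, algebraMap_mem_image_iff, algebraMap_mem_image_iff]
      exact hP.mem_or_mem hxy
    · exact Or.inl (hmul P y x (by rwa [mul_comm]) ⟨t, by rw [ht, inv_mul_cancel₀ hy]⟩)
  · exact Or.inr (hmul P x y hxy ⟨r, by rw [hr, inv_mul_cancel₀ hx]⟩)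

/-- The maximal ideals of an almost pseudo-valuation domain coincide. -/
theorem IsAPVD.isLocalRing (h : IsAPVD S) : IsLocalRing S := by
  refine IsLocalRing.of_unique_max_ideal ?_
  obtain ⟨M, hM⟩ := Ideal.exists_maximal S
  refine ⟨M, hM, fun N hN => hN.eq_of_le hM.ne_top fun y hy => ?_⟩
  by_contra hyM
  have hNM : ¬ M ≤ N := fun hle => hyM ((hM.eq_of_le hN.ne_top hle) ▸ hy)
  obtain ⟨x, hxM, hxN⟩ := Set.not_subset.1 hNM
  have hy0 : algebraMap S (FractionRing S) y ≠ 0 := by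
    rw [Ne, IsFractionRing.to_map_eq_zero_iff]
    rintro rfl; exact hyM (zero_mem _)
  rcases h M hM.isPrime (algebraMap S _ x / algebraMap S _ y) (algebraMap S _ y)
    (by rw [div_mul_cancel₀ _ hy0, algebraMap_mem_image_iff]; exact hxM) with ⟨z, hz, hzxy⟩ | ⟨n, -, hn⟩
  · rw [eq_div_iff hy0, ← map_mul] at hzxy
    rw [← IsFractionRing.injective S (FractionRing S) hzxy] at hxN
    exact hxN (N.mul_mem_left _ hy)
  · rw [← map_pow, algebraMap_mem_image_iff] at hn
    exact hyM (hM.isPrime.mem_of_pow_mem n hn)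

variable [IsLocalRing S]

theorem mem_mulMaximalColon_iff_le {x s : S} : s ∈ mulMaximalColon x ↔
    Ideal.span {s} * maximalIdeal S ≤ Ideal.span {x} * maximalIdeal S := by
  rw [mem_mulMaximalColon]
  refine ⟨fun h z hz => ?_, fun h m hm => h (Ideal.mem_span_singleton_mul.2 ⟨m, hm, rfl⟩)⟩
  obtain ⟨m, hm, rfl⟩ := Ideal.mem_span_singleton_mul.1 hz
  exact h m hm

/-- If neither alternative holds, powers of both `y / x` and `x / y` lie in `M`; suitable powers of
these multiply to `1`. -/
theorem IsStronglyPrimary.mem_mulMaximalColon_or (h : IsStronglyPrimary (maximalIdeal S)) (x y : S)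
    (hx : x ≠ 0) (hy : y ≠ 0) : x ∈ mulMaximalColon y ∨ y ∈ mulMaximalColon x := by
  have hx' : algebraMap S (FractionRing S) x ≠ 0 := by simpa using hx
  have hy' : algebraMap S (FractionRing S) y ≠ 0 := by simpa using hy
  -- either all quotients `m * b / c` lie in the maximal ideal, or a power of `c / b` does
  have key : ∀ b c : S, b ≠ 0 → c ≠ 0 → b ∈ mulMaximalColon c ∨
      ∃ n : ℕ, 0 < n ∧ (algebraMap S (FractionRing S) c / algebraMap S _ b) ^ n ∈
        algebraMap S (FractionRing S) '' (maximalIdeal S : Set S) := by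
    intro b c hb hc
    have hb' : algebraMap S (FractionRing S) b ≠ 0 := by simpa using hb
    have hc' : algebraMap S (FractionRing S) c ≠ 0 := by simpa using hc
    refine or_iff_not_imp_right.2 fun hn => mem_mulMaximalColon.2 fun m hm => ?_
    rcases h (algebraMap S _ (b * m) / algebraMap S _ c) (algebraMap S _ c / algebraMap S _ b)
      (by
        have : algebraMap S (FractionRing S) (b * m) / algebraMap S _ c *
            (algebraMap S _ c / algebraMap S _ b) = algebraMap S _ m := by
          rw [map_mul]; field_simp
        rw [this, algebraMap_mem_image_iff]; exact hm) with ⟨z, hz, hzm⟩ | h1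
    · rw [eq_div_iff hc', ← map_mul] at hzm
      exact Ideal.mem_span_singleton_mul.2
        ⟨z, hz, by rw [mul_comm, IsFractionRing.injective S (FractionRing S) hzm]⟩
    · exact absurd h1 hn
  rcases key x y hx hy with h1 | ⟨n, hn, z, hz, hzn⟩
  · exact Or.inl h1
  rcases key y x hy hx with h1 | ⟨k, hk, w, hw, hwk⟩
  · exact Or.inr h1
  exfalso
  have h1 : z ^ k * w ^ n = 1 := by
    refine IsFractionRing.injective S (FractionRing S) ?_
    rw [map_mul, map_pow, map_pow, hzn, hwk, map_one, ← pow_mul, ← pow_mul, mul_comm k n, ← mul_pow,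
      div_mul_div_comm, mul_comm, div_self (mul_ne_zero hx' hy'), one_pow]
  refine (Ideal.ne_top_iff_one _).1 (maximalIdeal.isMaximal S).ne_top ?_
  rw [← h1]
  exact Ideal.mul_mem_right _ _ (Ideal.pow_mem_of_mem _ hz k hk)

/-- With `M = aV`, one has `aM = a²V`. So `y ∉ aM` forces `a²M ⊆ yM`, while `M² ⊆ aM` gives `M³ ⊆
a²M`. -/
theorem isAbsorbingParameter_three {a : S} (ha0 : a ≠ 0) (ha : a ∈ maximalIdeal S)
    (hV : ∀ y, y ≠ 0 → y ∈ mulMaximalColon (a * a) ∨ a * a ∈ mulMaximalColon y)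
    (haM : ∀ x ∈ maximalIdeal S, x ∈ mulMaximalColon a)
    (harch : ∀ x ≠ 0, ∃ n : ℕ, x ∉ Ideal.span {a ^ n} * maximalIdeal S) :
    IsAbsorbingParameter 3 a := by
  refine ⟨ha0, ha, harch, fun y hy hya => ?_⟩
  have hy0 : y ≠ 0 := by rintro rfl; exact hya (zero_mem _)
  have hMM : maximalIdeal S * maximalIdeal S ≤ Ideal.span {a} * maximalIdeal S :=
    Ideal.mul_le.2 fun x hx z hz => mem_mulMaximalColon.1 (haM x hx) z hz
  have h2 : a * a ∈ mulMaximalColon y := by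
    refine (hV y hy0).resolve_left fun h => hya ?_
    have h4 := mem_mulMaximalColon.1 h a ha
    rw [mul_comm y a] at h4
    exact (mul_mem_span_singleton_mul_iff ha0).1 h4
  have h3 : maximalIdeal S * (maximalIdeal S * maximalIdeal S) ≤
      Ideal.span {a * a} * maximalIdeal S := by
    refine (Ideal.mul_mono_right hMM).trans ?_
    rw [mul_left_comm, ← Ideal.span_singleton_mul_span_singleton, mul_assoc]
    exact Ideal.mul_mono_right hMM
  rw [pow_succ', sq]
  exact (h3.trans (mem_mulMaximalColon_iff_le.1 h2)).trans Ideal.mul_le_left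

/-- For `m ∈ M`, apply strong primeness to `(y / a) * (a * m / y) = m`. This sharper dichotomy
compares `y` with `a` instead of `a²` and saves one power of `M`. -/
theorem IsStronglyPrime.mem_or_mem_mulMaximalColon (h : IsStronglyPrime (maximalIdeal S)) (y a : S)
    (hy : y ≠ 0) (ha : a ≠ 0) : y ∈ Ideal.span {a} * maximalIdeal S ∨ a ∈ mulMaximalColon y := by
  have hy' : algebraMap S (FractionRing S) y ≠ 0 := by simpa using hy
  have ha' : algebraMap S (FractionRing S) a ≠ 0 := by simpa using ha
  refine or_iff_not_imp_left.2 fun hn => mem_mulMaximalColon.2 fun m hm => ?_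
  rcases h (algebraMap S _ y / algebraMap S _ a) (algebraMap S _ (a * m) / algebraMap S _ y)
    (by
      have : algebraMap S (FractionRing S) y / algebraMap S _ a *
          (algebraMap S _ (a * m) / algebraMap S _ y) = algebraMap S _ m := by
        rw [map_mul]; field_simp
      rw [this, algebraMap_mem_image_iff]; exact hm) with ⟨z, hz, hzm⟩ | ⟨z, hz, hzm⟩
  · rw [eq_div_iff ha', ← map_mul] at hzm
    exact absurd (Ideal.mem_span_singleton_mul.2
      ⟨z, hz, by rw [mul_comm, IsFractionRing.injective S (FractionRing S) hzm]⟩) hn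
  · rw [eq_div_iff hy', ← map_mul] at hzm
    exact Ideal.mem_span_singleton_mul.2
      ⟨z, hz, by rw [mul_comm, IsFractionRing.injective S (FractionRing S) hzm]⟩

theorem IsMoriDomain.exists_isAbsorbingParameter_three (hS : IsMoriDomain S)
    (hM : maximalIdeal S ≠ ⊥) (h : IsAPVD S) : ∃ a : S, IsAbsorbingParameter 3 a := by
  have hV := (h _ (maximalIdeal.isMaximal S).isPrime).mem_mulMaximalColon_or
  obtain ⟨a, ha0, ha, haM, harch⟩ := hS.exists_generator hM hV
  exact ⟨a, isAbsorbingParameter_three ha0 ha (fun y hy => hV y _ hy (mul_ne_zero ha0 ha0)) haM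
    harch⟩

theorem IsMoriDomain.exists_isAbsorbingParameter_two (hS : IsMoriDomain S)
    (hM : maximalIdeal S ≠ ⊥) (h : IsPVD S) : ∃ a : S, IsAbsorbingParameter 2 a := by
  have hM' := h _ (maximalIdeal.isMaximal S).isPrime
  obtain ⟨a, ha0, ha, haM, harch⟩ :=
    hS.exists_generator hM hM'.isStronglyPrimary.mem_mulMaximalColon_or
  refine ⟨a, ha0, ha, harch, fun y hy hya => ?_⟩
  have hy0 : y ≠ 0 := by rintro rfl; exact hya (zero_mem _)
  have h2 := (hM'.mem_or_mem_mulMaximalColon y a hy0 ha0).resolve_left hya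
  calc maximalIdeal S ^ 2 = maximalIdeal S * maximalIdeal S := by ring
    _ ≤ Ideal.span {a} * maximalIdeal S :=
        Ideal.mul_le.2 fun x hx z hz => mem_mulMaximalColon.1 (haM x hx) z hz
    _ ≤ Ideal.span {y} * maximalIdeal S := mem_mulMaximalColon_iff_le.1 h2
    _ ≤ Ideal.span {y} := Ideal.mul_le_left

/-- Here `M = (a)`, so an element of `M` outside `aM` is an associate of `a`. -/
theorem IsMoriDomain.exists_isAbsorbingParameter_one (hS : IsMoriDomain S)
    (hM : maximalIdeal S ≠ ⊥) (h : ValuationRing S) : ∃ a : S, IsAbsorbingParameter 1 a := by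
  have hM' := ValuationRing.isPVD h _ (maximalIdeal.isMaximal S).isPrime
  obtain ⟨a, ha0, ha, haM, harch⟩ :=
    hS.exists_generator hM hM'.isStronglyPrimary.mem_mulMaximalColon_or
  have hdvd : ∀ x ∈ maximalIdeal S, a ∣ x := by
    intro x hx
    rcases ValuationRing.dvd_total a x with hax | ⟨t, ht⟩
    · exact hax
    have ht' : IsUnit t := by
      by_contra ht'
      refine notMem_span_singleton_mul_maximalIdeal ha0 ?_
      have := mem_mulMaximalColon.1 (haM x hx) t ht'
      rwa [← ht] at this
    rw [ht, ht'.mul_right_dvd]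
  refine ⟨a, ha0, ha, harch, fun y hy hya => ?_⟩
  obtain ⟨t, rfl⟩ := hdvd y hy
  have ht : IsUnit t := by
    by_contra ht
    exact hya (Ideal.mem_span_singleton_mul.2 ⟨t, ht, rfl⟩)
  rw [pow_one]
  intro x hx
  rw [Ideal.mem_span_singleton, ht.mul_right_dvd]
  exact hdvd x hx

end LocalPseudoValuation

/-! ### From localizations to the whole Mori domain -/

section Globalization

open IsLocalRing

variable {R : Type u} [CommRing R]

theorem Ideal.prod_sup_le_sup_prod {ι : Type*} (t : Finset ι) (I : Ideal R) (A : ι → Ideal R) :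
    ∏ i ∈ t, (I ⊔ A i) ≤ I ⊔ ∏ i ∈ t, A i := by
  classical
  induction t using Finset.induction_on with
  | empty => simp
  | insert i t hi ih =>
    rw [Finset.prod_insert hi, Finset.prod_insert hi]
    refine (Ideal.mul_mono_right ih).trans ?_
    rw [Ideal.sup_mul]
    refine sup_le (le_sup_of_le_left Ideal.mul_le_left) ?_
    rw [Ideal.mul_sup]
    exact sup_le (le_sup_of_le_left Ideal.mul_le_right) le_sup_right

/-- An ideal containing a product of powers of distinct maximal ideals is the product of the
primary ideals it induces. -/
theorem Ideal.prod_sup_pow_eq {I : Ideal R} (t : Finset (MaximalSpectrum R))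
    (k : MaximalSpectrum R → ℕ) (h : ∏ M ∈ t, M.asIdeal ^ k M ≤ I) :
    ∏ M ∈ t, (I ⊔ M.asIdeal ^ k M) = I := by
  refine le_antisymm ((Ideal.prod_sup_le_sup_prod t I _).trans (sup_le le_rfl h)) ?_
  rw [Ideal.prod_eq_iInf_of_pairwise_isCoprime]
  · exact le_iInf₂ fun M _ => le_sup_left
  · intro M _ N _ hMN
    have h1 : IsCoprime M.asIdeal N.asIdeal := Ideal.isCoprime_of_isMaximal fun h =>
      hMN (MaximalSpectrum.ext h)
    have h2 := Ideal.isCoprime_iff_sup_eq.1 (h1.pow (m := k M) (n := k N))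
    refine Ideal.isCoprime_iff_sup_eq.2 (top_le_iff.1 ?_)
    rw [← h2]
    exact sup_le_sup le_sup_right le_sup_right

theorem Ideal.IsMaximal.comap_map_of_pow_le {M J : Ideal R} [hM : M.IsMaximal] {k : ℕ}
    (hJ : M ^ k ≤ J) : (J.map (algebraMap R (Localization.AtPrime M))).comap
      (algebraMap R (Localization.AtPrime M)) = J := by
  refine le_antisymm (fun x hx => ?_) Ideal.le_comap_map
  rw [Ideal.mem_comap, IsLocalization.algebraMap_mem_map_algebraMap_iff M.primeCompl] at hx
  obtain ⟨s, hs, hsx⟩ := hx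
  exact hM.mem_of_mul_mem_of_pow_le hJ hs hsx

theorem maximalIdeal_localization_ne_bot [IsDomain R] (hR : ¬ IsField R) (M : Ideal R)
    [hM : M.IsMaximal] : maximalIdeal (Localization.AtPrime M) ≠ ⊥ := by
  have hinj := IsLocalization.injective (Localization.AtPrime M) M.primeCompl_le_nonZeroDivisors
  intro h
  refine Ring.ne_bot_of_isMaximal_of_not_isField hM hR ?_
  rw [← Localization.AtPrime.map_eq_maximalIdeal, Ideal.map_eq_bot_iff_of_injective hinj] at h
  exact h

/-- Ideals containing a power of `M` are recovered from their extensions to the localization. Both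
`Q` and the product of the contracted factors are of this kind, so it suffices to compare
extensions. -/
theorem Ideal.IsMaximal.exists_prod_eq_of_isAbsorbingParameter [IsDomain R] {M Q : Ideal R}
    [hM : M.IsMaximal] {N : ℕ} {a : Localization.AtPrime M} (ha : IsAbsorbingParameter N a)
    (hM0 : M ≠ ⊥) {k : ℕ} (hQ : M ^ k ≤ Q) (hQM : Q ≠ ⊤) :
    ∃ s : Multiset (Ideal R), (∀ J ∈ s, IsNAbsorbing N J) ∧ s.prod = Q := by
  have hinj := IsLocalization.injective (Localization.AtPrime M) M.primeCompl_le_nonZeroDivisors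
  have hQ0 : Q ≠ ⊥ := fun h => by
    rw [h, le_bot_iff] at hQ
    exact hM0 (eq_zero_of_pow_eq_zero hQ)
  have hcm := Ideal.IsMaximal.comap_map_of_pow_le hQ
  obtain ⟨s, hs, hsQ⟩ := ha.exists_prod_eq (I := Q.map (algebraMap R (Localization.AtPrime M)))
    (fun h => hQ0 ((Ideal.map_eq_bot_iff_of_injective hinj).1 h)) (fun h => hQM (by
      rw [← hcm, h, Ideal.comap_top]))
  have hs' : ∀ J ∈ s, M ^ N ≤ J.comap (algebraMap R (Localization.AtPrime M)) ∧
      J.comap (algebraMap R (Localization.AtPrime M)) ≤ M := by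
    intro J hJ
    constructor
    · rw [← Ideal.map_le_iff_le_comap, Ideal.map_pow, Localization.AtPrime.map_eq_maximalIdeal]
      exact (hs J hJ).1
    · conv_rhs => rw [← IsLocalization.AtPrime.under_maximalIdeal (Localization.AtPrime M) M]
      exact Ideal.comap_mono (hs J hJ).2
  refine ⟨s.map (Ideal.comap (algebraMap R (Localization.AtPrime M))), fun J hJ => ?_, ?_⟩
  · obtain ⟨A, hA, rfl⟩ := Multiset.mem_map.1 hJ
    exact isNAbsorbing_of_pow_le hM (hs' A hA).1 (hs' A hA).2
  · have hle : M ^ (N * Multiset.card s) ≤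
        (s.map (Ideal.comap (algebraMap R (Localization.AtPrime M)))).prod := by
      clear hsQ hs
      induction s using Multiset.induction_on with
      | empty => simp
      | cons J s ih =>
        rw [Multiset.map_cons, Multiset.prod_cons, Multiset.card_cons, mul_add, mul_one, add_comm,
          pow_add]
        exact Ideal.mul_mono (hs' J (Multiset.mem_cons_self J s)).1
          (ih fun A hA => hs' A (Multiset.mem_cons_of_mem hA))
    rw [← Ideal.IsMaximal.comap_map_of_pow_le hle, ← hcm, ← hsQ]
    congr 1
    change Ideal.mapHom (algebraMap R (Localization.AtPrime M)) _ = _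
    rw [map_multiset_prod, Multiset.map_map]
    congr 1
    conv_rhs => rw [← Multiset.map_id s]
    refine Multiset.map_congr rfl fun J _ => ?_
    exact IsLocalization.map_under M.primeCompl (Localization.AtPrime M) J

variable [IsDomain R]

/-- Each `M` admits `s ∉ M` and `k` with `s M ^ k ⊆ (x)`. These `s` generate the unit ideal, and the
finitely many used to express `1` select the maximal ideals needed. -/
theorem IsMoriDomain.exists_prod_maximal_le (hR : IsMoriDomain R) {N : ℕ}
    (h : ∀ (M : Ideal R) [M.IsMaximal], ∃ a : Localization.AtPrime M, IsAbsorbingParameter N a)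
    {x : R} (hx : x ≠ 0) : ∃ (t : Finset (MaximalSpectrum R)) (k : MaximalSpectrum R → ℕ),
      ∏ M ∈ t, M.asIdeal ^ k M ≤ Ideal.span {x} := by
  have key : ∀ M : MaximalSpectrum R, ∃ s ∉ M.asIdeal, ∃ k : ℕ, ∀ r ∈ M.asIdeal ^ k, x ∣ s * r := by
    intro M
    have hinj := IsLocalization.injective (Localization.AtPrime M.asIdeal)
      M.asIdeal.primeCompl_le_nonZeroDivisors
    obtain ⟨a, ha⟩ := h M.asIdeal
    obtain ⟨k, hk⟩ := ha.exists_pow_le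
      (I := Ideal.span {algebraMap R (Localization.AtPrime M.asIdeal) x})
      (by rw [Ne, Ideal.span_singleton_eq_bot]; exact (map_ne_zero_iff _ hinj).2 hx)
    obtain ⟨s, hs, hsr⟩ := hR.exists_common_denom M.asIdeal 1 hx
    refine ⟨s, hs, k, fun r hr => ?_⟩
    have := hsr r (by
      rw [← Ideal.mem_span_singleton, one_mul]
      refine hk ?_
      rw [← Localization.AtPrime.map_eq_maximalIdeal, ← Ideal.map_pow]
      exact Ideal.mem_map_of_mem _ hr)
    rwa [mul_one] at this
  choose s hs k hk using key
  have htop : Ideal.span (Set.range s) = ⊤ := by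
    by_contra hne
    obtain ⟨M, hM, hle⟩ := Ideal.exists_le_maximal _ hne
    exact hs ⟨M, hM⟩ (hle (Ideal.subset_span ⟨_, rfl⟩))
  obtain ⟨c, hc⟩ := Finsupp.mem_span_range_iff_exists_finsupp.1 ((Ideal.eq_top_iff_one _).1 htop)
  refine ⟨c.support, k, fun r hr => ?_⟩
  rw [← mul_one r, ← hc, Finsupp.sum, Finset.mul_sum]
  refine Ideal.sum_mem _ fun M hM => ?_
  have hrM : r ∈ M.asIdeal ^ k M :=
    (Ideal.le_of_dvd (Finset.dvd_prod_of_mem (fun M => M.asIdeal ^ k M) hM)) hr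
  rw [smul_eq_mul, mul_left_comm, mul_comm r]
  exact Ideal.mul_mem_left _ _ (Ideal.mem_span_singleton.2 (hk M r hrM))

/-- A Mori domain all of whose localizations at maximal ideals have an absorbing parameter is a
domain with absorbing factorization. -/
theorem IsMoriDomain.hasAbsorbingFactorization (hR : IsMoriDomain R) {N : ℕ} (hN : 0 < N)
    (h : ¬ IsField R → ∀ (M : Ideal R) [M.IsMaximal],
      ∃ a : Localization.AtPrime M, IsAbsorbingParameter N a) :
    HasAbsorbingFactorization R N := by
  classical
  intro I hI
  by_cases hI0 : I = ⊥
  · exact ⟨{⊥}, fun J hJ => by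
      rw [Multiset.mem_singleton.1 hJ]; exact Ideal.isPrime_bot.isNAbsorbing hN, by simp [hI0]⟩
  have hf : ¬ IsField R := fun hf => by
    obtain ⟨x, hxI, hx0⟩ := (Submodule.ne_bot_iff _).1 hI0
    obtain ⟨y, hy⟩ := hf.mul_inv_cancel hx0
    exact hI ((Ideal.eq_top_iff_one _).2 (hy ▸ I.mul_mem_right y hxI))
  obtain ⟨x, hxI, hx0⟩ := (Submodule.ne_bot_iff _).1 hI0
  obtain ⟨t, k, htk⟩ := hR.exists_prod_maximal_le (h hf) hx0
  have hprod := Ideal.prod_sup_pow_eq t k (htk.trans ((Ideal.span_singleton_le_iff_mem I).2 hxI))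
  have hfac : ∀ M : MaximalSpectrum R, ∃ s : Multiset (Ideal R),
      (∀ J ∈ s, IsNAbsorbing N J) ∧ s.prod = I ⊔ M.asIdeal ^ k M := by
    intro M
    by_cases htop : I ⊔ M.asIdeal ^ k M = ⊤
    · exact ⟨0, by simp, by simp [htop]⟩
    · obtain ⟨a, ha⟩ := h hf M.asIdeal
      exact Ideal.IsMaximal.exists_prod_eq_of_isAbsorbingParameter ha
        (Ring.ne_bot_of_isMaximal_of_not_isField M.isMaximal hf) le_sup_right htop
  choose s hs hsp using hfac
  refine ⟨∑ M ∈ t, s M, fun J hJ => ?_, ?_⟩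
  · obtain ⟨M, -, hJM⟩ := Multiset.mem_sum.1 hJ
    exact hs M J hJM
  · rw [Multiset.prod_sum, ← hprod]
    exact Finset.prod_congr rfl fun M _ => hsp M

theorem IsMoriDomain.hasAbsorbingFactorization_three (hR : IsMoriDomain R) (h : IsLAPVD R) :
    HasAbsorbingFactorization R 3 :=
  hR.hasAbsorbingFactorization (by norm_num) fun hf M _ =>
    (hR.localization M).exists_isAbsorbingParameter_three (maximalIdeal_localization_ne_bot hf M)
      (h M)

theorem IsMoriDomain.hasAbsorbingFactorization_two (hR : IsMoriDomain R) (h : IsLPVD R) :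
    HasAbsorbingFactorization R 2 :=
  hR.hasAbsorbingFactorization (by norm_num) fun hf M _ =>
    (hR.localization M).exists_isAbsorbingParameter_two (maximalIdeal_localization_ne_bot hf M)
      (h M)

theorem IsMoriDomain.hasAbsorbingFactorization_one (hR : IsMoriDomain R) (h : IsPruferDomain R) :
    HasAbsorbingFactorization R 1 :=
  hR.hasAbsorbingFactorization (by norm_num) fun hf M _ =>
    (hR.localization M).exists_isAbsorbingParameter_one (maximalIdeal_localization_ne_bot hf M)
      (h M)

end Globalization

/-! ### One-dimensional APVDs -/

section OneDimensional

open IsLocalRing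

theorem IsAPVD.hasAbsorbingFactorization_three {R : Type u} [CommRing R] [IsDomain R]
    (h : IsAPVD R) (hdim : ringKrullDim R = 1) {M : Ideal R} (hM : M.IsMaximal)
    {V : Subalgebra R (FractionRing R)} {a : V}
    (ha : (algebraMap R (FractionRing R)) '' (M : Set R) =
      Subtype.val '' (Ideal.span {a} : Set V)) :
    HasAbsorbingFactorization R 3 := by
  have hloc := h.isLocalRing
  obtain rfl := eq_maximalIdeal hM
  have hdim' : Ring.KrullDimLE 1 R := Ring.krullDimLE_iff.2 hdim.le
  have hinj := IsFractionRing.injective R (FractionRing R)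
  obtain ⟨b, hb, hba⟩ : (a : FractionRing R) ∈
      (algebraMap R (FractionRing R)) '' (maximalIdeal R : Set R) :=
    ha ▸ ⟨a, Ideal.mem_span_singleton_self a, rfl⟩
  have hdvd : ∀ x ∈ maximalIdeal R, ∃ v : V,
      algebraMap R (FractionRing R) x = algebraMap R (FractionRing R) b * v := by
    intro x hx
    obtain ⟨w, hw, hwx⟩ : algebraMap R (FractionRing R) x ∈
      Subtype.val '' (Ideal.span {a} : Set V) := ha ▸ ⟨x, hx, rfl⟩
    obtain ⟨v, rfl⟩ := Ideal.mem_span_singleton.1 hw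
    exact ⟨v, by rw [← hwx, hba]; rfl⟩
  have hmul : ∀ v : V, ∃ x ∈ maximalIdeal R,
      algebraMap R (FractionRing R) x = algebraMap R (FractionRing R) b * v := by
    intro v
    obtain ⟨x, hx, hxv⟩ : (a * v : V).1 ∈
      (algebraMap R (FractionRing R)) '' (maximalIdeal R : Set R) :=
        ha ▸ ⟨a * v, Ideal.mem_span_singleton.2 (dvd_mul_right a v), rfl⟩
    exact ⟨x, hx, by rw [hxv, hba]; rfl⟩
  have hb0 : b ≠ 0 := by
    rintro rfl
    have hbot : maximalIdeal R = ⊥ := (Submodule.eq_bot_iff _).2 fun x hx => by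
      obtain ⟨v, hv⟩ := hdvd x hx
      rw [map_zero, zero_mul] at hv
      exact hinj (by rw [hv, map_zero])
    have := ringKrullDim_eq_zero_of_isField (isField_iff_maximalIdeal_eq.2 hbot)
    rw [hdim] at this
    exact one_ne_zero this
  have hparam : IsAbsorbingParameter 3 b := by
    have hV := (h _ (maximalIdeal.isMaximal R).isPrime).mem_mulMaximalColon_or
    refine isAbsorbingParameter_three hb0 hb (fun y hy => hV y _ hy (mul_ne_zero hb0 hb0))
      (fun x hx => mem_mulMaximalColon.2 fun m hm => ?_) fun x hx => ?_
    · obtain ⟨v, hv⟩ := hdvd x hx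
      obtain ⟨w, hw⟩ := hdvd m hm
      obtain ⟨z, hz, hzw⟩ := hmul (v * w)
      refine Ideal.mem_span_singleton_mul.2 ⟨z, hz, hinj ?_⟩
      rw [map_mul, map_mul, hv, hw, hzw]
      push_cast
      ring
    -- In dimension one `M` is the only nonzero prime, so some `bⁿ` lies in `(x)`; then `x ∈ bⁿM`
    -- would give `bⁿ ∈ bⁿM`.
    · have hrad : b ∈ (Ideal.span {x}).radical := by
        rw [Ideal.radical_eq_sInf, Submodule.mem_sInf]
        rintro P ⟨hxP, hP⟩
        have hP0 : P ≠ ⊥ := (Submodule.ne_bot_iff _).2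
          ⟨x, hxP (Ideal.mem_span_singleton_self x), hx⟩
        rw [eq_maximalIdeal (hP.isMaximal_of_ne_bot hP0)]
        exact hb
      obtain ⟨n, hn⟩ := hrad
      refine ⟨n, fun hxn => ?_⟩
      refine notMem_span_singleton_mul_maximalIdeal (pow_ne_zero n hb0) ?_
      exact (Ideal.span_singleton_le_iff_mem _).2 hxn hn
  intro I hI
  by_cases hI0 : I = ⊥
  · exact ⟨{⊥}, fun J hJ => by
      rw [Multiset.mem_singleton.1 hJ]; exact Ideal.isPrime_bot.isNAbsorbing (by norm_num),
      by simp [hI0]⟩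
  · obtain ⟨s, hs, hsI⟩ := hparam.exists_prod_eq hI0 hI
    exact ⟨s, fun J hJ => isNAbsorbing_of_pow_le hM (hs J hJ).1 (hs J hJ).2, hsI⟩

end OneDimensional

/-! ### Radicals of 2-absorbing ideals and irreducible elements -/

section TwoAbsorbing

variable {R : Type u} [CommRing R]

theorem IsNAbsorbing.mul_mem_radical {I : Ideal R} (hI : IsNAbsorbing 2 I) {x y z : R}
    (h : x * y * z ∈ I.radical) :
    x * y ∈ I.radical ∨ x * z ∈ I.radical ∨ y * z ∈ I.radical := by
  have h2 := hI.sq_mem_of_mem_radical h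
  rw [mul_pow, mul_pow] at h2
  simp only [Ideal.mem_radical_iff]
  rcases hI.mul_mem h2 with h | h | h
  · exact Or.inl ⟨2, by rwa [mul_pow]⟩
  · exact Or.inr (Or.inl ⟨2, by rwa [mul_pow]⟩)
  · exact Or.inr (Or.inr ⟨2, by rwa [mul_pow]⟩)

/-- If the radical `N` of a `2`-absorbing ideal is not prime, witnessed by `a * b ∈ N`, then the
ideal quotient `N : a` is prime. -/
theorem IsNAbsorbing.isPrime_comap_mulLeft {I : Ideal R} (hI : IsNAbsorbing 2 I) {a b : R}
    (hab : a * b ∈ I.radical) (ha : a ∉ I.radical) (hb : b ∉ I.radical) :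
    Ideal.IsPrime (Submodule.comap (LinearMap.mulLeft R a) I.radical) := by
  set N := I.radical with hN
  have hmem : ∀ {c}, c ∈ (Submodule.comap (LinearMap.mulLeft R a) N : Ideal R) ↔ a * c ∈ N :=
    Iff.rfl
  refine ⟨(Ideal.ne_top_iff_one _).2 fun h => ha (by simpa using hmem.1 h), fun {c d} hcd => ?_⟩
  simp only [hmem] at hcd ⊢
  by_contra hc
  push Not at hc
  obtain ⟨hc, hd⟩ := hc
  have h1 : c * d ∈ N := by
    rcases hI.mul_mem_radical (x := a) (y := c) (z := d) (by convert hcd using 1; ring) with h | h | h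
    · exact absurd h hc
    · exact absurd h hd
    · exact h
  -- Perturbing by `b`, which `a` kills modulo `N`, turns the exclusions for `c` and `d` into `c * b
  -- ∈ N`. Doing this to both factors ends with `b ^ 2 ∈ N`.
  have step : ∀ c d, a * c ∉ N → a * d ∉ N → c * d ∈ N → c * b ∈ N := by
    intro c d hc hd h1
    rcases hI.mul_mem_radical (x := a) (y := c) (z := d + b) (by
      have := N.add_mem (N.mul_mem_left a h1) (N.mul_mem_left c hab)
      convert this using 1; ring) with h | h | h
    · exact absurd h hc
    · exact absurd (by convert N.sub_mem h hab using 1; ring) hd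
    · convert N.sub_mem h h1 using 1; ring
  have h2 := step c d hc hd h1
  have h3 := step d c hd hc (by rwa [mul_comm])
  rcases hI.mul_mem_radical (x := a) (y := c + b) (z := d + b) (by
    have := N.add_mem (N.mul_mem_left a h1) (N.mul_mem_left (c + d + b) hab)
    convert this using 1; ring) with h | h | h
  · exact absurd (by convert N.sub_mem h hab using 1; ring) hc
  · exact absurd (by convert N.sub_mem h hab using 1; ring) hd
  · have : b ^ 2 ∈ N := by
      convert N.sub_mem (N.sub_mem (N.sub_mem h h1) h2) h3 using 1; ring
    exact hb ((Ideal.radical_isRadical I) ⟨2, this⟩)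

open IsLocalRing

/-- A `2`-absorbing ideal with non-maximal radical `N` in a local ring admits an element of the
maximal ideal which is regular modulo `N`. -/
theorem IsNAbsorbing.exists_regular_mod_radical [IsLocalRing R] {I : Ideal R}
    (hI : IsNAbsorbing 2 I) (h : I.radical ≠ maximalIdeal R) :
    ∃ m ∈ maximalIdeal R, ∀ c, m * c ∈ I.radical → c ∈ I.radical := by
  have hne : I.radical ≠ ⊤ := by
    rw [Ne, Ideal.radical_eq_top]; exact hI.1
  by_cases hp : I.radical.IsPrime
  · obtain ⟨m, hm, hmI⟩ := Set.not_subset.1 fun hle =>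
      h (le_antisymm (le_maximalIdeal hne) hle)
    exact ⟨m, hm, fun c hc => (hp.mem_or_mem hc).resolve_left hmI⟩
  obtain ⟨a, b, hab, ha, hb⟩ : ∃ a b, a * b ∈ I.radical ∧ a ∉ I.radical ∧ b ∉ I.radical := by
    by_contra hc
    push Not at hc
    exact hp ⟨hne, fun {x y} hxy => or_iff_not_imp_left.2 fun hx => hc x y hxy hx⟩
  have hba : b * a ∈ I.radical := by rwa [mul_comm]
  have h1 := hI.isPrime_comap_mulLeft hab ha hb
  have h2 := hI.isPrime_comap_mulLeft hba hb ha
  set N := I.radical with hN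
  have hsq : ∀ x, x * x ∈ N → x ∈ N := fun x hx => (Ideal.radical_isRadical I) ⟨2, by rwa [sq]⟩
  have hmem : ∀ {a c}, c ∈ (Submodule.comap (LinearMap.mulLeft R a) N : Ideal R) ↔ a * c ∈ N :=
    Iff.rfl
  have hlt : ∀ a b, a * b ∈ N → a ∉ N → b ∉ N →
      ¬ maximalIdeal R ≤ (Submodule.comap (LinearMap.mulLeft R a) N : Ideal R) := by
    intro a b hab ha hb hle
    by_cases haM : a ∈ maximalIdeal R
    · exact ha (hsq a (hmem.1 (hle haM)))
    · have : IsUnit a := by simpa using haM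
      exact hb ((Ideal.unit_mul_mem_iff_mem N this).1 hab)
  -- Prime avoidance for the two primes `N : a` and `N : b`.
  obtain ⟨m, hm, hmu⟩ := Set.not_subset.1 fun hle =>
    (Ideal.subset_union.1 hle).elim (hlt a b hab ha hb) (hlt b a hba hb ha)
  simp only [Set.mem_union, SetLike.mem_coe, not_or] at hmu
  refine ⟨m, hm, fun c hc => ?_⟩
  have hca : a * c ∈ N := hmem.1 <| (h1.mem_or_mem (hmem.2 (N.mul_mem_left a hc))).resolve_left hmu.1
  have hcb : b * c ∈ N := hmem.1 <| (h2.mem_or_mem (hmem.2 (N.mul_mem_left b hc))).resolve_left hmu.2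
  -- All of `a * b`, `a * c`, `b * c` lie in `N`, so the three cases reduce to `b² ∈ N`, `a² ∈ N` or
  -- `c² ∈ N`; only the last is possible.
  rcases hI.mul_mem_radical (x := a + b) (y := b + c) (z := a + c) (by
    have h3 : (a + b) * (b + c) * (a + c) =
      (a + b + c + c) * (a * b) + (a + c) * (a * c) + (b + c) * (b * c) := by ring
    rw [h3]
    exact N.add_mem (N.add_mem (N.mul_mem_left _ hab) (N.mul_mem_left _ hca))
      (N.mul_mem_left _ hcb)) with h | h | h
  · refine absurd (hsq b ?_) hb
    convert N.sub_mem (N.sub_mem (N.sub_mem h hab) hca) hcb using 1; ring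
  · refine absurd (hsq a ?_) ha
    convert N.sub_mem (N.sub_mem (N.sub_mem h hab) hca) hcb using 1; ring
  · refine hsq c ?_
    convert N.sub_mem (N.sub_mem (N.sub_mem h hab) hca) hcb using 1; ring

theorem Multiset.pow_card_le_prod_le {A B : Ideal R} {s : Multiset (Ideal R)}
    (h : ∀ J ∈ s, A ≤ J ∧ J ≤ B) :
    A ^ Multiset.card s ≤ s.prod ∧ s.prod ≤ B ^ Multiset.card s := by
  induction s using Multiset.induction_on with
  | empty => simp
  | cons J s ih =>
    have h1 := h J (Multiset.mem_cons_self J s)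
    have h2 := ih fun A hA => h A (Multiset.mem_cons_of_mem hA)
    rw [Multiset.prod_cons, Multiset.card_cons, pow_succ', pow_succ']
    exact ⟨Ideal.mul_mono h1.1 h2.1, Ideal.mul_mono h1.2 h2.2⟩

variable [IsDomain R] [IsLocalRing R]

/-- In a local domain with `2`-absorbing factorization, a nonzero `2`-absorbing element and an
element outside the radical of the ideal it generates cannot generate an ideal which is primary
to the maximal ideal. -/
theorem HasAbsorbingFactorization.mem_radical (hR : HasAbsorbingFactorization R 2) {x m : R}
    (hx0 : x ≠ 0) (hx : IsNAbsorbing 2 (Ideal.span {x})) (hm : m ∈ maximalIdeal R)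
    (hrad : maximalIdeal R ≤ (Ideal.span {x, m}).radical) : m ∈ (Ideal.span {x}).radical := by
  by_contra hmx
  have hxM : x ∈ maximalIdeal R := le_maximalIdeal hx.1 (Ideal.mem_span_singleton_self x)
  -- Here `k` is the number of factors of `(x, mⁿ)`, each lying between `M²` and `M`. If `2 * k <
  -- n`, then `m ^ (2 * k)` times a unit would lie in `(x)`.
  have key : ∀ n, 0 < n → ∃ k, maximalIdeal R ^ (2 * k) ≤ Ideal.span {x, m ^ n} ∧
      Ideal.span {x, m ^ n} ≤ maximalIdeal R ^ k ∧ n ≤ 2 * k := by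
    intro n hn
    have hle : Ideal.span {x, m ^ n} ≤ maximalIdeal R := by
      rw [Ideal.span_le, Set.pair_subset_iff]
      exact ⟨hxM, Ideal.pow_mem_of_mem _ hm n hn⟩
    have hradn : maximalIdeal R ≤ (Ideal.span {x, m ^ n}).radical := by
      refine hrad.trans (Ideal.radical_le_radical_iff.2 ?_)
      rw [Ideal.span_le, Set.pair_subset_iff]
      exact ⟨Ideal.le_radical (Ideal.subset_span (by simp)),
        ⟨n, Ideal.subset_span (by simp)⟩⟩
    obtain ⟨s, hs, hsI⟩ := hR (Ideal.span {x, m ^ n})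
      fun h => (maximalIdeal.isMaximal R).ne_top (top_le_iff.1 (h ▸ hle))
    have hs' : ∀ J ∈ s, maximalIdeal R ^ 2 ≤ J ∧ J ≤ maximalIdeal R := by
      intro J hJ
      refine ⟨(hs J hJ).sq_radical_le ?_ (maximalIdeal.isMaximal R).isPrime,
        le_maximalIdeal (hs J hJ).1⟩
      refine le_antisymm (le_maximalIdeal ?_) (hradn.trans (Ideal.radical_mono ?_))
      · rw [Ne, Ideal.radical_eq_top]; exact (hs J hJ).1
      · rw [← hsI]; exact Ideal.le_of_dvd (Multiset.dvd_prod hJ)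
    obtain ⟨h1, h2⟩ := Multiset.pow_card_le_prod_le hs'
    rw [hsI] at h1 h2
    rw [← pow_mul] at h1
    refine ⟨_, h1, h2, ?_⟩
    by_contra hlt
    obtain ⟨j, hj⟩ := Nat.exists_eq_add_of_lt (not_le.1 hlt)
    obtain ⟨α, β, hαβ⟩ := Ideal.mem_span_pair.1
      (h1 (Ideal.pow_mem_pow hm (2 * Multiset.card s)))
    have hu : IsUnit (1 - β * m ^ (j + 1)) :=
      isUnit_one_sub_self_of_mem_nonunits _
        (Ideal.mul_mem_left _ _ (Ideal.pow_mem_of_mem _ hm (j + 1) j.succ_pos))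
    refine hmx ⟨2 * Multiset.card s, ?_⟩
    rw [← Ideal.unit_mul_mem_iff_mem _ hu]
    refine Ideal.mem_span_singleton'.2 ⟨α, ?_⟩
    rw [hj] at hαβ
    linear_combination hαβ
  obtain ⟨k, hk, -, -⟩ := key 3 (by norm_num)
  -- This exponent forces `l ≥ 2 * k + 1`, so `x ∈ M ^ (2 * k + 1) ⊆ (x, m³)M`. Solving for `x`
  -- gives `m³ ∣ x`, which contradicts 2-absorption on `m * m * (m * s)`.
  obtain ⟨l, -, hl, hkl⟩ := key (2 * (2 * k + 1)) (by omega)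
  have hxk : x ∈ Ideal.span {x, m ^ 3} * maximalIdeal R := by
    refine Ideal.mul_mono_left hk ?_
    rw [← pow_succ]
    exact Ideal.pow_le_pow_right (by omega) (hl (Ideal.subset_span (by simp)))
  rw [Ideal.span_insert, Ideal.sup_mul, Submodule.mem_sup] at hxk
  obtain ⟨p, hp, q, hq, hpq⟩ := hxk
  obtain ⟨α, hα, rfl⟩ := Ideal.mem_span_singleton_mul.1 hp
  obtain ⟨β, hβ, rfl⟩ := Ideal.mem_span_singleton_mul.1 hq
  obtain ⟨u, hu⟩ : IsUnit (1 - α) := isUnit_one_sub_self_of_mem_nonunits _ hα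
  obtain ⟨s, rfl⟩ : ∃ s, x = m ^ 3 * s := by
    refine ⟨β * ↑u⁻¹, ?_⟩
    rw [← mul_assoc, Units.eq_mul_inv_iff_mul_eq, hu]
    linear_combination -hpq
  have hm0 : m ≠ 0 := by rintro rfl; simp at hx0
  have hs0 : s ≠ 0 := by rintro rfl; simp at hx0
  have hcase : m * (m * s) ∉ Ideal.span {m ^ 3 * s} := by
    intro h
    obtain ⟨t, ht⟩ := Ideal.mem_span_singleton.1 h
    have : m * t = 1 := by
      refine mul_left_cancel₀ (mul_ne_zero (pow_ne_zero 2 hm0) hs0) ?_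
      linear_combination -ht
    exact (mem_maximalIdeal m).1 hm (IsUnit.of_mul_eq_one t this)
  rcases hx.mul_mem (x := m) (y := m) (z := m * s)
    (Ideal.mem_span_singleton.2 ⟨1, by ring⟩) with h | h | h
  · exact hmx ⟨2, by rwa [sq]⟩
  · exact hcase h
  · exact hcase h

/-- If both ideals were proper, each product `i * j` would lie in `xM`, a unit cofactor being a
nontrivial factorization of `x`. Then `x ∈ xM`, which is absurd. -/
theorem Irreducible.eq_top_or_eq_top_of_mul_eq_span {x : R} (hx : Irreducible x) {A B : Ideal R}
    (h : A * B = Ideal.span {x}) : A = ⊤ ∨ B = ⊤ := by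
  by_contra hc
  push Not at hc
  refine notMem_span_singleton_mul_maximalIdeal hx.ne_zero
    ((?_ : A * B ≤ Ideal.span {x} * maximalIdeal R) (h ▸ Ideal.mem_span_singleton_self x))
  refine Ideal.mul_le.2 fun i hi j hj => ?_
  obtain ⟨r, hr⟩ := Ideal.mem_span_singleton.1 (h ▸ Ideal.mul_mem_mul hi hj)
  refine Ideal.mem_span_singleton_mul.2 ⟨r, fun hu => ?_, hr.symm⟩
  obtain ⟨u, rfl⟩ := hu
  have : x = i * (j * ↑u⁻¹) := by
    rw [← mul_assoc, hr, mul_assoc, Units.mul_inv, mul_one]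
  rcases hx.isUnit_or_isUnit this with h1 | h1
  · exact le_maximalIdeal hc.1 hi h1
  · exact le_maximalIdeal hc.2 (B.mul_mem_right _ hj) h1

theorem HasAbsorbingFactorization.isNAbsorbing_span_irreducible {n : ℕ}
    (hR : HasAbsorbingFactorization R n) {x : R} (hx : Irreducible x) :
    IsNAbsorbing n (Ideal.span {x}) := by
  have hne : Ideal.span {x} ≠ ⊤ := fun h => hx.not_isUnit (Ideal.span_singleton_eq_top.1 h)
  obtain ⟨s, hs, hsx⟩ := hR _ hne
  induction s using Multiset.induction_on with
  | empty => exact absurd (by simpa using hsx.symm) hne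
  | cons J s _ =>
    have hJ := hs J (Multiset.mem_cons_self J s)
    rw [Multiset.prod_cons] at hsx
    have := (hx.eq_top_or_eq_top_of_mul_eq_span hsx).resolve_left hJ.1
    rw [this, Ideal.mul_top] at hsx
    rwa [← hsx]

/-- Otherwise take `m ∈ M` regular modulo the radical and localize at a prime `Q` minimal over `(x,
m)`. Irreducibility may be lost there, but `(x)` stays 2-absorbing, so
`HasAbsorbingFactorization.mem_radical` gives `s * mʲ ∈ (x)` with `s ∉ Q`. Regularity then puts `s`
in the radical of `(x)`, hence in `Q`. -/
theorem HasAbsorbingFactorization.radical_span_irreducible (hR : HasAbsorbingFactorization R 2)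
    {x : R} (hx : Irreducible x) : (Ideal.span {x}).radical = maximalIdeal R := by
  have hx2 := hR.isNAbsorbing_span_irreducible hx
  by_contra hne
  obtain ⟨m, hm, hreg⟩ := hx2.exists_regular_mod_radical hne
  have hle : Ideal.span {x, m} ≤ maximalIdeal R := by
    rw [Ideal.span_le, Set.pair_subset_iff]
    exact ⟨hx.not_isUnit, hm⟩
  obtain ⟨Q, hQ, -⟩ := Ideal.exists_minimalPrimes_le hle
  have hQp : Q.IsPrime := hQ.1.1
  have hxQ : x ∈ Q := hQ.1.2 (Ideal.subset_span (by simp))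
  have hmQ : m ∈ Q := hQ.1.2 (Ideal.subset_span (by simp))
  have hinj := IsLocalization.injective (Localization.AtPrime Q) Q.primeCompl_le_nonZeroDivisors
  have hmap : (Ideal.span {x}).map (algebraMap R (Localization.AtPrime Q)) =
      Ideal.span {algebraMap R (Localization.AtPrime Q) x} := by
    rw [Ideal.map_span, Set.image_singleton]
  have hmem : ∀ {y}, y ∈ Q → algebraMap R (Localization.AtPrime Q) y ∈
      maximalIdeal (Localization.AtPrime Q) := fun hy => by
    rw [← Localization.AtPrime.map_eq_maximalIdeal]; exact Ideal.mem_map_of_mem _ hy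
  have hx2' := hx2.map_localization Q (by
    rw [hmap]
    intro h
    exact hmem hxQ (Ideal.span_singleton_eq_top.1 h))
  rw [hmap] at hx2'
  have hmr := (hR.localization Q).mem_radical ((map_ne_zero_iff _ hinj).2 hx.ne_zero) hx2'
    (hmem hmQ) (by
      rw [Ideal.radical_eq_sInf]
      refine le_sInf fun J hJ => ?_
      obtain ⟨hJ, hJp⟩ := hJ
      rw [Ideal.span_le, Set.pair_subset_iff] at hJ
      have h1 : Q ≤ J.comap (algebraMap R (Localization.AtPrime Q)) := by
        refine hQ.2 ⟨Ideal.comap_isPrime _ _, ?_⟩ ?_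
        · rw [Ideal.span_le, Set.pair_subset_iff]; exact hJ
        · conv_rhs => rw [← IsLocalization.AtPrime.under_maximalIdeal (Localization.AtPrime Q) Q]
          exact Ideal.comap_mono (le_maximalIdeal hJp.ne_top)
      rw [← Localization.AtPrime.map_eq_maximalIdeal]
      exact Ideal.map_le_iff_le_comap.2 h1)
  obtain ⟨j, hj⟩ := hmr
  rw [← hmap, ← map_pow, IsLocalization.algebraMap_mem_map_algebraMap_iff Q.primeCompl] at hj
  obtain ⟨s, hs, hsj⟩ := hj
  have hregj : ∀ j, m ^ j * s ∈ (Ideal.span {x}).radical → s ∈ (Ideal.span {x}).radical := by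
    intro j
    induction j with
    | zero => intro h; simpa using h
    | succ j ih => intro h; exact ih (hreg _ (by rwa [← mul_assoc, ← pow_succ']))
  refine hs ((hQp.radical_le_iff.2 ?_) (hregj j (Ideal.le_radical (by rwa [mul_comm]))))
  exact (Ideal.span_singleton_le_iff_mem _).2 hxQ

end TwoAbsorbing

/-! ### The discrete value function and the local converses -/

section TwoAbsorbingLocal

open IsLocalRing

variable {S : Type u} [CommRing S] [IsDomain S] [IsLocalRing S]

theorem Irreducible.maximalIdeal_mul_self_le {x : S} (hx : Irreducible x)
    (h : maximalIdeal S ^ 2 ≤ Ideal.span {x}) :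
    maximalIdeal S * maximalIdeal S ≤ Ideal.span {x} * maximalIdeal S := by
  refine Ideal.mul_le.2 fun m hm n hn => ?_
  obtain ⟨r, hr⟩ := Ideal.mem_span_singleton.1 (h (by rw [sq]; exact Ideal.mul_mem_mul hm hn))
  refine Ideal.mem_span_singleton_mul.2 ⟨r, fun hu => ?_, hr.symm⟩
  obtain ⟨u, rfl⟩ := hu
  have : x = m * (n * ↑u⁻¹) := by
    rw [← mul_assoc, hr, mul_assoc, Units.mul_inv, mul_one]
  rcases hx.isUnit_or_isUnit this with h1 | h1
  · exact hm h1
  · exact (Ideal.mul_mem_right _ _ hn : n * ↑u⁻¹ ∈ maximalIdeal S) h1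

theorem HasAbsorbingFactorization.maximalIdeal_mul_self_le (hS : HasAbsorbingFactorization S 2)
    {x : S} (hx : Irreducible x) :
    maximalIdeal S * maximalIdeal S ≤ Ideal.span {x} * maximalIdeal S :=
  hx.maximalIdeal_mul_self_le <| (hS.isNAbsorbing_span_irreducible hx).sq_radical_le
    (hS.radical_span_irreducible hx) (maximalIdeal.isMaximal S).isPrime

/-- Every nonzero element `r` of an atomic local domain with `2`-absorbing factorization has a
value `n` with `r M = aⁿ M`, for a fixed irreducible element `a`. -/
theorem HasAbsorbingFactorization.exists_span_mul_eq [WfDvdMonoid S]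
    (hS : HasAbsorbingFactorization S 2) {a : S} (ha : Irreducible a) (r : S) (hr : r ≠ 0) :
    ∃ n : ℕ, Ideal.span {r} * maximalIdeal S = Ideal.span {a ^ n} * maximalIdeal S := by
  induction r using WfDvdMonoid.induction_on_irreducible with
  | zero => exact absurd rfl hr
  | unit u hu =>
    exact ⟨0, by rw [Ideal.span_singleton_eq_top.2 hu, pow_zero, Ideal.span_singleton_one]⟩
  | mul r i hr0 hi ih =>
    obtain ⟨n, hn⟩ := ih hr0
    -- Since `xM ⊆ M² ⊆ yM`, symmetry shows that all irreducibles have the same multiple of `M`; the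
    -- exponent counts irreducible factors.
    have hle : ∀ {x y : S}, Irreducible x → Irreducible y →
        Ideal.span {x} * maximalIdeal S ≤ Ideal.span {y} * maximalIdeal S := fun {x y} hx hy =>
      (Ideal.mul_mono_left ((Ideal.span_singleton_le_iff_mem _).2 hx.not_isUnit)).trans
        (hS.maximalIdeal_mul_self_le hy)
    refine ⟨n + 1, ?_⟩
    rw [← Ideal.span_singleton_mul_span_singleton, mul_assoc, hn, mul_left_comm,
      le_antisymm (hle hi ha) (hle ha hi), ← mul_assoc, Ideal.span_singleton_mul_span_singleton,
      pow_succ]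

theorem le_of_span_pow_mul_le {a : S} (ha0 : a ≠ 0) (ha : a ∈ maximalIdeal S) {n k : ℕ}
    (h : Ideal.span {a ^ n} * maximalIdeal S ≤ Ideal.span {a ^ k} * maximalIdeal S) : k ≤ n := by
  by_contra hlt
  refine notMem_span_singleton_mul_maximalIdeal (pow_ne_zero (n + 1) ha0) ?_
  have h1 : a ^ (n + 1) ∈ Ideal.span {a ^ k} * maximalIdeal S :=
    h (Ideal.mem_span_singleton_mul.2 ⟨a, ha, (pow_succ a n).symm⟩)
  refine Ideal.mul_mono_left ?_ h1
  exact Ideal.span_singleton_le_span_singleton.2 (pow_dvd_pow a (by omega))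

theorem isPVD_of_maximalIdeal_eq_bot (h : maximalIdeal S = ⊥) : IsPVD S := by
  intro P hP
  have : P = ⊥ := le_bot_iff.1 (h ▸ le_maximalIdeal hP.ne_top)
  rw [this]
  exact isStronglyPrime_bot

theorem exists_irreducible_of_maximalIdeal_ne_bot [WfDvdMonoid S] (h : maximalIdeal S ≠ ⊥) :
    ∃ a : S, Irreducible a := by
  obtain ⟨x, hx, hx0⟩ := (Submodule.ne_bot_iff _).1 h
  obtain ⟨a, ha, -⟩ := WfDvdMonoid.exists_irreducible_factor hx hx0
  exact ⟨a, ha⟩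

theorem HasAbsorbingFactorization.isPVD [WfDvdMonoid S] (hS : HasAbsorbingFactorization S 2) :
    IsPVD S := by
  by_cases hM : maximalIdeal S = ⊥
  · exact isPVD_of_maximalIdeal_eq_bot hM
  obtain ⟨a, ha⟩ := exists_irreducible_of_maximalIdeal_ne_bot hM
  have hex := hS.exists_span_mul_eq ha
  have ha0 := ha.ne_zero
  have haM : a ∈ maximalIdeal S := ha.not_isUnit
  intro P hP
  by_cases hP0 : P = ⊥
  · rw [hP0]; exact isStronglyPrime_bot
  -- A nonzero prime contains some `aⁿM`, hence `a`, hence `M²`.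
  obtain rfl : P = maximalIdeal S := by
    refine le_antisymm (le_maximalIdeal hP.ne_top) fun x hx => ?_
    obtain ⟨r, hrP, hr0⟩ := (Submodule.ne_bot_iff _).1 hP0
    obtain ⟨n, hn⟩ := hex r hr0
    have h1 : Ideal.span {a ^ n} * maximalIdeal S ≤ P :=
      hn ▸ Ideal.mul_le_left.trans ((Ideal.span_singleton_le_iff_mem _).2 hrP)
    have h2 : a ∈ P := hP.mem_of_pow_mem (n + 1)
      (h1 (Ideal.mem_span_singleton_mul.2 ⟨a, haM, (pow_succ a n).symm⟩))
    have h3 : x * x ∈ P := ((hS.maximalIdeal_mul_self_le ha).trans (Ideal.mul_le_left.trans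
      ((Ideal.span_singleton_le_iff_mem _).2 h2))) (Ideal.mul_mem_mul hx hx)
    exact (hP.mem_or_mem h3).elim id id
  have hlt : ∀ {r s : S} {n k : ℕ},
      Ideal.span {r} * maximalIdeal S = Ideal.span {a ^ n} * maximalIdeal S →
      Ideal.span {s} * maximalIdeal S = Ideal.span {a ^ k} * maximalIdeal S → k < n →
      r ∈ Ideal.span {s} * maximalIdeal S := by
    intro r s n k hr hs hkn
    rw [← mul_mem_span_singleton_mul_iff ha0]
    have h1 : a * r ∈ Ideal.span {a ^ n} * maximalIdeal S :=
      hr ▸ Ideal.mem_span_singleton_mul.2 ⟨a, haM, mul_comm r a⟩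
    have h2 : a * r ∈ Ideal.span {a ^ (k + 1)} * maximalIdeal S :=
      Ideal.mul_mono_left (Ideal.span_singleton_le_span_singleton.2 (pow_dvd_pow a hkn)) h1
    rwa [pow_succ', ← Ideal.span_singleton_mul_span_singleton, mul_assoc, ← hs, ← mul_assoc,
      Ideal.span_singleton_mul_span_singleton] at h2
  have hmul : ∀ {r s : S} {n k : ℕ},
      Ideal.span {r} * maximalIdeal S = Ideal.span {a ^ n} * maximalIdeal S →
      Ideal.span {s} * maximalIdeal S = Ideal.span {a ^ k} * maximalIdeal S →
      Ideal.span {r * s} * maximalIdeal S = Ideal.span {a ^ (n + k)} * maximalIdeal S := by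
    intro r s n k hr hs
    rw [← Ideal.span_singleton_mul_span_singleton, mul_assoc, hs, mul_left_comm, hr, ← mul_assoc,
      Ideal.span_singleton_mul_span_singleton, ← pow_add, add_comm]
  have hmem : ∀ {r s : S}, s ≠ 0 → r ∈ Ideal.span {s} * maximalIdeal S →
      algebraMap S (FractionRing S) r / algebraMap S (FractionRing S) s ∈
        algebraMap S (FractionRing S) '' (maximalIdeal S : Set S) := by
    intro r s hs hr
    obtain ⟨z, hz, rfl⟩ := Ideal.mem_span_singleton_mul.1 hr
    have hs' : algebraMap S (FractionRing S) s ≠ 0 := by simpa using hs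
    exact ⟨z, hz, by rw [map_mul, mul_div_cancel_left₀ _ hs']⟩
  intro x y hxy
  obtain ⟨r, s, hs, rfl⟩ := IsFractionRing.div_surjective (A := S) x
  obtain ⟨t, u, hu, rfl⟩ := IsFractionRing.div_surjective (A := S) y
  obtain ⟨m, hm, hmxy⟩ := hxy
  have hs := nonZeroDivisors.ne_zero hs
  have hu := nonZeroDivisors.ne_zero hu
  have hs' : algebraMap S (FractionRing S) s ≠ 0 := by simpa using hs
  have hu' : algebraMap S (FractionRing S) u ≠ 0 := by simpa using hu
  have heq : r * t = m * (s * u) := by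
    refine IsFractionRing.injective S (FractionRing S) ?_
    simp only [map_mul, hmxy]
    field_simp
  by_cases hr : r = 0
  · exact Or.inl (hmem hs (hr ▸ zero_mem _))
  by_cases ht : t = 0
  · exact Or.inr (hmem hu (ht ▸ zero_mem _))
  have hm0 : m ≠ 0 := by
    rintro rfl
    rw [zero_mul] at heq
    exact mul_ne_zero hr ht heq
  obtain ⟨nr, hnr⟩ := hex r hr
  obtain ⟨ns, hns⟩ := hex s hs
  obtain ⟨nt, hnt⟩ := hex t ht
  obtain ⟨nu, hnu⟩ := hex u hu
  obtain ⟨nm, hnm⟩ := hex m hm0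
  -- Value zero would mean `mM = M`, factoring the irreducible `a` into two elements of `M`. With
  -- `m` of positive value, the numerator of `x` or of `y` has larger value than its denominator.
  have hnm0 : nm ≠ 0 := by
    rintro rfl
    rw [pow_zero, Ideal.span_singleton_one, Ideal.top_mul] at hnm
    obtain ⟨z, hz, hza⟩ := Ideal.mem_span_singleton_mul.1 (hnm.symm ▸ haM)
    exact (ha.isUnit_or_isUnit hza.symm).elim hm hz
  have h1 := hmul hnr hnt
  have h2 := hmul hnm (hmul hns hnu)
  rw [← heq, h1] at h2
  have h3 := le_of_span_pow_mul_le ha0 haM h2.le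
  by_cases hlt' : ns < nr
  · exact Or.inl (hmem hs (hlt hnr hns hlt'))
  · exact Or.inr (hmem hu (hlt hnt hnu (by omega)))

theorem HasAbsorbingFactorization.two_of_one {R : Type u} [CommRing R]
    (h : HasAbsorbingFactorization R 1) : HasAbsorbingFactorization R 2 := fun I hI => by
  obtain ⟨s, hs, hsI⟩ := h I hI
  exact ⟨s, fun J hJ => (hs J hJ).isPrime.isNAbsorbing (by norm_num), hsI⟩

theorem HasAbsorbingFactorization.valuationRing [WfDvdMonoid S]
    (hS : HasAbsorbingFactorization S 1) : ValuationRing S := by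
  refine ValuationRing.iff_dvd_total.2 ⟨fun r s => ?_⟩
  by_cases hM : maximalIdeal S = ⊥
  · by_cases hr : IsUnit r
    · exact Or.inl hr.dvd
    · have : r ∈ maximalIdeal S := hr
      rw [hM, Ideal.mem_bot] at this
      exact Or.inr (this ▸ dvd_zero s)
  obtain ⟨a, ha⟩ := exists_irreducible_of_maximalIdeal_ne_bot hM
  -- A 1-absorbing ideal is prime, and `M² ⊆ (a)`. With `M = (a)` principal, `sM ⊆ rM` cancels to `r
  -- ∣ s`.
  have hMa : maximalIdeal S ≤ Ideal.span {a} := fun x hx => by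
    have h1 := (hS.two_of_one.maximalIdeal_mul_self_le ha).trans Ideal.mul_le_left
      (Ideal.mul_mem_mul hx hx)
    exact ((hS.isNAbsorbing_span_irreducible ha).isPrime.mem_or_mem h1).elim id id
  have key : ∀ {r s : S},
      Ideal.span {s} * maximalIdeal S ≤ Ideal.span {r} * maximalIdeal S → r ∣ s := by
    intro r s h
    obtain ⟨z, hz, hzs⟩ := Ideal.mem_span_singleton_mul.1
      (h (Ideal.mem_span_singleton_mul.2 ⟨a, ha.not_isUnit, rfl⟩))
    obtain ⟨w, rfl⟩ := Ideal.mem_span_singleton.1 (hMa hz)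
    refine ⟨w, mul_right_cancel₀ ha.ne_zero ?_⟩
    rw [← hzs]; ring
  by_cases hr : r = 0
  · exact Or.inr (hr ▸ dvd_zero s)
  by_cases hs : s = 0
  · exact Or.inl (hs ▸ dvd_zero r)
  obtain ⟨n, hn⟩ := hS.two_of_one.exists_span_mul_eq ha r hr
  obtain ⟨k, hk⟩ := hS.two_of_one.exists_span_mul_eq ha s hs
  have hle : ∀ {n k : ℕ}, n ≤ k → Ideal.span {a ^ k} * maximalIdeal S ≤
      Ideal.span {a ^ n} * maximalIdeal S := fun h =>
    Ideal.mul_mono_left (Ideal.span_singleton_le_span_singleton.2 (pow_dvd_pow a h))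
  exact (le_total n k).imp (fun h => key (hn ▸ hk ▸ hle h)) fun h => key (hn ▸ hk ▸ hle h)

end TwoAbsorbingLocal

/-! ### Global converses and the theorem -/

section Main

variable {R : Type u} [CommRing R] [IsDomain R]

theorem IsMoriDomain.isLPVD (hR : IsMoriDomain R) (h : HasAbsorbingFactorization R 2) :
    IsLPVD R := fun M _ =>
  have := (hR.localization M).wfDvdMonoid
  (h.localization M).isPVD

theorem IsMoriDomain.isPruferDomain (hR : IsMoriDomain R) (h : HasAbsorbingFactorization R 1) :
    IsPruferDomain R := fun M _ =>
  have := (hR.localization M).wfDvdMonoid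
  (h.localization M).valuationRing

end Main

theorem theorem4p6 (R : Type u) [CommRing R] [IsDomain R] :
    (IsAPVD R → ringKrullDim R = 1 →
      ∀ (M : Ideal R), M.IsMaximal →
      ∀ (V : Subalgebra R (FractionRing R)), IsAssociatedValuationOverring R V →
        (∃ a : V, (algebraMap R (FractionRing R)) '' (M : Set R) =
          Subtype.val '' (Ideal.span {a} : Set V)) →
        AFdim R ≤ 3) ∧
    (IsMoriDomain R → IsLAPVD R → AFdim R ≤ 3) ∧
    (IsMoriDomain R →
      (AFdim R = 1 ↔ IsPruferDomain R) ∧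
      (AFdim R = 2 ↔ IsLPVD R ∧ ¬ IsPruferDomain R) ∧
      (IsLAPVD R ∧ ¬ IsLPVD R → AFdim R = 3)) := by
  have one_iff : AFdim R = 1 ↔ _ := AFdim_eq_iff (R := R) (n := 1) (by norm_num)
  have two_iff : AFdim R = 2 ↔ _ := AFdim_eq_iff (R := R) (n := 2) (by norm_num)
  have three_iff : AFdim R = 3 ↔ _ := AFdim_eq_iff (R := R) (n := 3) (by norm_num)
  refine ⟨fun h hdim M hM V _ ⟨a, ha⟩ =>
      AFdim_le (by norm_num) (h.hasAbsorbingFactorization_three hdim hM ha),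
    fun hR h => AFdim_le (by norm_num) (hR.hasAbsorbingFactorization_three h), fun hR => ?_⟩
  rw [one_iff, two_iff, three_iff]
  refine ⟨⟨fun h => hR.isPruferDomain h.1, fun h =>
      ⟨hR.hasAbsorbingFactorization_one h, fun m hm hm' => by omega⟩⟩,
    ⟨fun h => ⟨hR.isLPVD h.1, fun hP =>
      h.2 1 (by norm_num) (by norm_num) (hR.hasAbsorbingFactorization_one hP)⟩, fun h =>
      ⟨hR.hasAbsorbingFactorization_two h.1, fun m hm hm2 hf => ?_⟩⟩,
    fun h => ⟨hR.hasAbsorbingFactorization_three h.1, fun m hm hm3 hf => ?_⟩⟩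
  · obtain rfl : m = 1 := by omega
    exact h.2 (hR.isPruferDomain hf)
  · obtain rfl | rfl : m = 1 ∨ m = 2 := by omega
    · exact h.2 (hR.isLPVD hf.two_of_one)
    · exact h.2 (hR.isLPVD hf)
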